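/- Let $a,\beta$ be nonzero real numbers. For $(x,y,t)\in\mathbb R^3$ and $b\in\mathbb C$ put $$\psi(b;x,y,t)=\exp\big[\mathrm i bx+\sqrt{a^2-b^2}\,(\mathrm i y-2bt)\big],\qquad \phi(b;x,y,t)=\frac{b+\mathrm i\sqrt{a^2-b^2}}{a}\,\psi(b;x,y,t),$$ with the principal square root, and for $k\ge 0$ let $$\psi^{[k]}=\frac1{k!}\,\partial_b^k\psi\big|_{b=\mathrm i\beta},\qquad \phi^{[k]}=\frac1{k!}\,\partial_b^k\phi\big|_{b=\mathrm i\beta}$$ be the Taylor coefficients at $b=\mathrm i\beta$. Each $\Psi=(\psi^{[k]},\phi^{[k]})^T$ is an eigenfunction for the seed $u=-v=a$: it solves the Lax pair $\Psi_y=J\Psi_x+U\Psi$, $\Psi_t=2J\Psi_{xx}+2U\Psi_x+V\Psi$ with $J=\mathrm{diag}(\mathrm i,-\mathrm i)$, $U=\begin{pmatrix}0&u\\ v&0\end{pmatrix}$, $V=\begin{pmatrix}(w+\mathrm iQ)/2&u_x-\mathrm iu_y\\ v_x+\mathrm iv_y&(w-\mathrm iQ)/2\end{pmatrix}$ for $u=-v=a$,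 $Q=w=0$. Let $n\ge1$, let $k_1,\dots,k_n$ be distinct nonnegative integers, and write $\psi_j=\psi^{[k_j]}$, $\phi_j=\phi^{[k_j]}$. Let $\delta_1$ be the determinant of the $2n\times 2n$ matrix whose rows are, for $m=n-1,n-2,\dots,0$, first $$(\partial_x^m\psi_1,\dots,\partial_x^m\psi_n,\ \partial_x^m\phi_1^*,\dots,\partial_x^m\phi_n^*)$$ and then, again for $m=n-1,\dots,0$, $$(\partial_x^m\phi_1,\dots,\partial_x^m\phi_n,\ -\partial_x^m\psi_1^*,\dots,-\partial_x^m\psi_n^*),$$ where $*$ is complex conjugation, and let $\delta_2$ be the determinant obtained from it on replacing row $n+1$ by $(\partial_x^n\psi_1,\dots,\partial_x^n\psi_n,\partial_x^n\phi_1^*,\dots,\partial_x^n\phi_n^*)$. Then the set $\Omega=\{\delta_1\neq0\}$ is open and dense in $\mathbb R^3$, and $$u^{[n]}=a+2\mathrm i\,\frac{\delta_2}{\delta_1}$$ is a rational solution on $\Omega$ of the focusing Davey–Stewartson II equation: on $\Omega$ the function $u^{[n]}$ is a quotient of polynomials in $x,y,t$ with nonvanishing denominator, and there is a real-valued $S$,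 rational in the same sense, such that $u=u^{[n]}$ and $S$ are smooth on $\Omega$ and satisfy there $$\mathrm i u_t+u_{xx}-u_{yy}+(S-2|u|^2)u=0,\qquad S_{xx}+S_{yy}=4(|u|^2)_{xx}.$$ -/

import Mathlib

open scoped ComplexConjugate

namespace DaveyStewartson

noncomputable section

/-- Partial derivative in the first variable of a function of `(x, y, t)`. -/
def dx {E : Type*} [NormedAddCommGroup E] [NormedSpace ℝ E] (f : ℝ → ℝ → ℝ → E) :
    ℝ → ℝ → ℝ → E :=
  fun x y t => deriv (fun s => f s y t) x

/-- Partial derivative in the second variable of a function of `(x, y, t)`. -/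
def dy {E : Type*} [NormedAddCommGroup E] [NormedSpace ℝ E] (f : ℝ → ℝ → ℝ → E) :
    ℝ → ℝ → ℝ → E :=
  fun x y t => deriv (fun s => f x s t) y

/-- Partial derivative in the third variable of a function of `(x, y, t)`. -/
def dt {E : Type*} [NormedAddCommGroup E] [NormedSpace ℝ E] (f : ℝ → ℝ → ℝ → E) :
    ℝ → ℝ → ℝ → E :=
  fun x y t => deriv (fun s => f x y s) t

/-- The function is smooth on the set `Ω` of points `(x, y, t)`. -/
def SmoothOn {E : Type*} [NormedAddCommGroup E] [NormedSpace ℝ E] (Ω : Set (ℝ × ℝ × ℝ))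
    (f : ℝ → ℝ → ℝ → E) : Prop :=
  ContDiffOn ℝ (⊤ : ℕ∞) (fun p : ℝ × ℝ × ℝ => f p.1 p.2.1 p.2.2) Ω

/-- `(u, S)` is a smooth solution on `Ω` (meant for open `Ω`) of the Davey-Stewartson II system
`i u_t + u_xx - u_yy + (2 κ |u|² + S) u = 0`, `S_xx + S_yy = -4 κ (|u|²)_xx`,
with `u` complex valued and `S` real valued. The focusing case is `κ = -1`. -/
def IsDSIISolution (κ : ℝ) (Ω : Set (ℝ × ℝ × ℝ)) (u : ℝ → ℝ → ℝ → ℂ) (S : ℝ → ℝ → ℝ → ℝ) :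
    Prop :=
  SmoothOn Ω u ∧ SmoothOn Ω S ∧
  ∀ x y t : ℝ, (x, y, t) ∈ Ω →
    Complex.I * dt u x y t + dx (dx u) x y t - dy (dy u) x y t
        + ((2 * κ * ‖u x y t‖ ^ 2 + S x y t : ℝ) : ℂ) * u x y t = 0 ∧
    dx (dx S) x y t + dy (dy S) x y t
        = -4 * κ * dx (dx (fun x y t => ‖u x y t‖ ^ 2)) x y t

/-- The column vector `Ψ = (ψ, φ)` is a smooth solution on all of `ℝ³` of the Lax pair
`Ψ_y = J Ψ_x + U Ψ`, `Ψ_t = 2 J Ψ_xx + 2 U Ψ_x + V Ψ` with `J = diag(i, -i)`,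
`U = ((0, u), (v, 0))`,
`V = (((w + i Q) / 2, u_x - i u_y), (v_x + i v_y, (w - i Q) / 2))`. -/
def IsLaxSolution (u v w Q ψ φ : ℝ → ℝ → ℝ → ℂ) : Prop :=
  SmoothOn Set.univ ψ ∧ SmoothOn Set.univ φ ∧
  ∀ x y t : ℝ,
    dy ψ x y t = Complex.I * dx ψ x y t + u x y t * φ x y t ∧
    dy φ x y t = -Complex.I * dx φ x y t + v x y t * ψ x y t ∧
    dt ψ x y t = 2 * Complex.I * dx (dx ψ) x y t + 2 * u x y t * dx φ x y t
        + (w x y t + Complex.I * Q x y t) / 2 * ψ x y t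
        + (dx u x y t - Complex.I * dy u x y t) * φ x y t ∧
    dt φ x y t = -2 * Complex.I * dx (dx φ) x y t + 2 * v x y t * dx ψ x y t
        + (dx v x y t + Complex.I * dy v x y t) * ψ x y t
        + (w x y t - Complex.I * Q x y t) / 2 * φ x y t

/-- The principal square root of `a² - b²`. -/
def root (a : ℝ) (b : ℂ) : ℂ := ((a : ℂ) ^ 2 - b ^ 2) ^ (1 / 2 : ℂ)

/-- First component `ψ` of the exponential eigenfunction with spectral parameter `b`. -/
def psi (a : ℝ) (b : ℂ) (x y t : ℝ) : ℂ :=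
  Complex.exp (Complex.I * b * x + root a b * (Complex.I * y - 2 * b * t))

/-- Second component `φ` of the exponential eigenfunction with spectral parameter `b`. -/
def phi (a : ℝ) (b : ℂ) (x y t : ℝ) : ℂ :=
  (b + root a b * Complex.I) / a *
    Complex.exp (Complex.I * b * x + root a b * (Complex.I * y - 2 * b * t))

/-- `k`-th Taylor coefficient of `b ↦ ψ` at `b = i β`. -/
def psiCoeff (a β : ℝ) (k : ℕ) (x y t : ℝ) : ℂ :=
  iteratedDeriv k (fun b : ℂ => psi a b x y t) (Complex.I * β) / (k.factorial : ℂ)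

/-- `k`-th Taylor coefficient of `b ↦ φ` at `b = i β`. -/
def phiCoeff (a β : ℝ) (k : ℕ) (x y t : ℝ) : ℂ :=
  iteratedDeriv k (fun b : ℂ => phi a b x y t) (Complex.I * β) / (k.factorial : ℂ)

/-- The row `(∂ₓᵐ ψ₁, …, ∂ₓᵐ ψₙ, ∂ₓᵐ φ₁*, …, ∂ₓᵐ φₙ*)`. -/
def upperRow {n : ℕ} (ψ φ : Fin n → ℝ → ℝ → ℝ → ℂ) (m : ℕ) (x y t : ℝ) : Fin n ⊕ Fin n → ℂ :=
  Sum.elim (fun j => (dx^[m] (ψ j)) x y t)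
    (fun j => (dx^[m] (fun x y t => conj (φ j x y t))) x y t)

/-- The row `(∂ₓᵐ φ₁, …, ∂ₓᵐ φₙ, -∂ₓᵐ ψ₁*, …, -∂ₓᵐ ψₙ*)`. -/
def lowerRow {n : ℕ} (ψ φ : Fin n → ℝ → ℝ → ℝ → ℂ) (m : ℕ) (x y t : ℝ) : Fin n ⊕ Fin n → ℂ :=
  Sum.elim (fun j => (dx^[m] (φ j)) x y t)
    (fun j => -(dx^[m] (fun x y t => conj (ψ j x y t))) x y t)

/-- The `2n × 2n` matrix of the Darboux transformation; from top to bottom, its rows are the upper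
rows of order `n - 1, …, 0`, then the lower rows of order `n - 1, …, 0`. -/
def darbouxMatrix {n : ℕ} (ψ φ : Fin n → ℝ → ℝ → ℝ → ℂ) (x y t : ℝ) :
    Matrix (Fin n ⊕ Fin n) (Fin n ⊕ Fin n) ℂ :=
  Matrix.of (Sum.elim (fun i => upperRow ψ φ (n - 1 - (i : ℕ)) x y t)
    (fun i => lowerRow ψ φ (n - 1 - (i : ℕ)) x y t))

/-- `δ₁`. -/
def delta1 {n : ℕ} (ψ φ : Fin n → ℝ → ℝ → ℝ → ℂ) (x y t : ℝ) : ℂ :=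
  (darbouxMatrix ψ φ x y t).det

/-- `δ₂`: row `n + 1` (the first row of the lower half) is replaced by the upper row of
order `n`. -/
def delta2 {n : ℕ} [NeZero n] (ψ φ : Fin n → ℝ → ℝ → ℝ → ℂ) (x y t : ℝ) : ℂ :=
  ((darbouxMatrix ψ φ x y t).updateRow (Sum.inr 0) (upperRow ψ φ n x y t)).det

/-- `u^[n] = a + 2 i δ₂ / δ₁` (meaningful where `δ₁ ≠ 0`). -/
def uDarboux {n : ℕ} [NeZero n] (a : ℝ) (ψ φ : Fin n → ℝ → ℝ → ℝ → ℂ) (x y t : ℝ) : ℂ :=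
  a + 2 * Complex.I * (delta2 ψ φ x y t / delta1 ψ φ x y t)

/-- The set of points `(x, y, t)` with `δ₁ ≠ 0`. -/
def regularSet {n : ℕ} (ψ φ : Fin n → ℝ → ℝ → ℝ → ℂ) : Set (ℝ × ℝ × ℝ) :=
  {p | delta1 ψ φ p.1 p.2.1 p.2.2 ≠ 0}

/-- On `Ω`, `f` is a quotient of two polynomials in `(x, y, t)` whose denominator has no zero
in `Ω`. -/
def IsRationalOn (Ω : Set (ℝ × ℝ × ℝ)) (f : ℝ → ℝ → ℝ → ℂ) : Prop :=
  ∃ P D : MvPolynomial (Fin 3) ℂ, ∀ x y t : ℝ, (x, y, t) ∈ Ω →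
    MvPolynomial.eval ![(x : ℂ), (y : ℂ), (t : ℂ)] D ≠ 0 ∧
    f x y t = MvPolynomial.eval ![(x : ℂ), (y : ℂ), (t : ℂ)] P
      / MvPolynomial.eval ![(x : ℂ), (y : ℂ), (t : ℂ)] D

end

end DaveyStewartson

open DaveyStewartson

/-! The solution formula is a Darboux dressing. Each column `(ψ_j, φ_j)` solves the Lax pair of the
constant seed, and since `v = -conj u` there, so does `(φ_j*, -ψ_j*)`. Where `δ₁ ≠ 0` there is a
unique monic operator `L = ∂ₓⁿ + A_{n-1} ∂ₓⁿ⁻¹ + ...` with `2 × 2` matrix coefficients killing all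
`2n` columns. The commutation defect `(∂_y - J∂ₓ - U₁) L - L (∂_y - J∂ₓ - U)`, and likewise the one
in `t`, kills the columns too; the choice of `U₁` and `V₁` removes its coefficients of order at
least `n`, so it vanishes. The resulting evolution equations for the `A_m` (`IsDressing.dy_eq`,
`IsDressing.dt_eq`) give the Davey–Stewartson system by elimination (`IsDressing.davey_stewartson`).
Cramer's rule identifies the off-diagonal entry of `A_{n-1}` with `-δ₂/δ₁`, and uniqueness of `L`
forces the conjugation symmetry `v = -conj u` and a real potential (`conj_symm`).

Rationality: every Taylor coefficient is a polynomial times one exponential, a factor common to each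
column that cancels in quotients of determinants.

Density: `δ₁` vanishes exactly where a polynomial does, so one nonzero value suffices. On the line
`y = t = 0`, replacing powers of `∂ₓ` by powers of `∂ₓ + β` and rescaling makes the matrix converge
as `x → ∞`. The limit is a quaternionic block matrix built on a Vandermonde-type determinant in the
distinct `k_j`, hence nonsingular (`regularSet_nonempty`). -/

namespace DaveyStewartson

/-! ### Derivatives in the spectral parameter of exponential modes. -/

section Jets

open Filter Topology

/-- The `k`-th derivative at `b` of `h b * exp (α b * s)` as a function of the spectral
parameter. -/
noncomputable def lineJet (α : ℂ → ℂ) (k : ℕ) (h : ℂ → ℂ) (b : ℂ) (s : ℝ) : ℂ :=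
  iteratedDeriv k (fun b => h b * Complex.exp (α b * s)) b

lemma iteratedDeriv_add_analytic {f g : ℂ → ℂ} {b : ℂ} (hf : AnalyticAt ℂ f b)
    (hg : AnalyticAt ℂ g b) (k : ℕ) :
    iteratedDeriv k (fun b => f b + g b) b = iteratedDeriv k f b + iteratedDeriv k g b :=
  iteratedDeriv_fun_add hf.contDiffAt hg.contDiffAt

lemma lineJet_succ {α h : ℂ → ℂ} {b : ℂ} (hα : AnalyticAt ℂ α b) (hh : AnalyticAt ℂ h b)
    (k : ℕ) (s : ℝ) :
    lineJet α (k + 1) h b s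
      = lineJet α k (deriv h) b s + s * lineJet α k (fun b => h b * deriv α b) b s := by
  have hE : AnalyticAt ℂ (fun b => Complex.exp (α b * s)) b := by fun_prop
  have e : deriv (fun b => h b * Complex.exp (α b * s)) =ᶠ[𝓝 b]
      fun b => deriv h b * Complex.exp (α b * s)
        + s * (h b * deriv α b * Complex.exp (α b * s)) := by
    filter_upwards [hα.eventually_analyticAt, hh.eventually_analyticAt] with z hz hz'
    have h1 := (hz.differentiableAt.hasDerivAt.mul_const (s : ℂ)).cexp
    rw [(hz'.differentiableAt.hasDerivAt.fun_mul h1).deriv]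
    ring
  have hα' := hα.deriv
  have hh' := hh.deriv
  unfold lineJet
  rw [iteratedDeriv_succ', (e.iteratedDeriv k).eq_of_nhds,
    iteratedDeriv_add_analytic (by fun_prop) (by fun_prop), iteratedDeriv_const_mul_field]

/-- Differentiation in `s` commutes with `∂_b^k`. Peeling off one `b`-derivative with `lineJet_succ`
lets induction on `k` replace any general theorem on exchanging partial derivatives. -/
lemma hasDerivAt_lineJet {α h : ℂ → ℂ} {b : ℂ} (hα : AnalyticAt ℂ α b) (hh : AnalyticAt ℂ h b)
    (k : ℕ) (s : ℝ) :
    HasDerivAt (lineJet α k h b) (lineJet α k (fun b => h b * α b) b s) s := by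
  induction k generalizing h with
  | zero =>
    have h1 : HasDerivAt (fun s : ℝ => Complex.exp (α b * s)) (Complex.exp (α b * s) * α b) s := by
      simpa using ((Complex.ofRealCLM.hasDerivAt (x := s)).const_mul (α b)).cexp
    have h2 := h1.const_mul (h b)
    simp only [lineJet, iteratedDeriv_zero]
    exact h2.congr_deriv (by ring)
  | succ k ih =>
    have hα' := hα.deriv
    have hh' := hh.deriv
    have h1 := (ih hh').fun_add ((Complex.ofRealCLM.hasDerivAt (x := s)).fun_mul
      (ih (hh.fun_mul hα')))
    have e : lineJet α (k + 1) h b = fun s : ℝ => lineJet α k (deriv h) b s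
        + Complex.ofRealCLM s * lineJet α k (fun b => h b * deriv α b) b s := by
      funext s; exact lineJet_succ hα hh k s
    rw [e, lineJet_succ hα (hh.fun_mul hα)]
    refine h1.congr_deriv ?_
    have e2 : deriv (fun b => h b * α b) =ᶠ[𝓝 b] fun b => deriv h b * α b + h b * deriv α b := by
      filter_upwards [hα.eventually_analyticAt, hh.eventually_analyticAt] with z hz hz'
      exact (hz'.differentiableAt.hasDerivAt.fun_mul hz.differentiableAt.hasDerivAt).deriv
    have e3 : lineJet α k (deriv fun b => h b * α b) b s
        = lineJet α k (fun b => deriv h b * α b) b s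
          + lineJet α k (fun b => h b * deriv α b) b s := by
      unfold lineJet
      rw [← iteratedDeriv_add_analytic (by fun_prop) (by fun_prop)]
      refine (EventuallyEq.iteratedDeriv ?_ k).eq_of_nhds
      filter_upwards [e2] with z hz
      rw [hz]; ring
    have e4 : (fun b => h b * α b * deriv α b) = fun b => h b * deriv α b * α b := by
      funext z; ring
    rw [e3, e4]
    simp
    ring

variable (α β γ : ℂ → ℂ)

/-- The `k`-th derivative at `b` of `h b * exp (α b * x + β b * y + γ b * t)` as a function of the
spectral parameter. -/
noncomputable def modeJet (k : ℕ) (h : ℂ → ℂ) (b : ℂ) (x y t : ℝ) : ℂ :=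
  iteratedDeriv k (fun b => h b * Complex.exp (α b * x + β b * y + γ b * t)) b

variable {α β γ} {h : ℂ → ℂ} {b : ℂ}

lemma hasDerivAt_modeJet_x (hα : AnalyticAt ℂ α b) (hβ : AnalyticAt ℂ β b)
    (hγ : AnalyticAt ℂ γ b) (hh : AnalyticAt ℂ h b) (k : ℕ) (x y t : ℝ) :
    HasDerivAt (fun s => modeJet α β γ k h b s y t)
      (modeJet α β γ k (fun b => h b * α b) b x y t) x := by
  -- The exponential in the frozen variables is absorbed into the amplitude.
  have := hasDerivAt_lineJet (h := fun b => h b * Complex.exp (β b * y + γ b * t)) hα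
    (by fun_prop) k x
  unfold lineJet at this
  convert! this using 1
  · funext s; unfold modeJet; congr 1; funext z
    rw [mul_assoc, ← Complex.exp_add]; ring_nf
  · unfold modeJet; congr 1; funext z
    rw [mul_right_comm, mul_assoc, mul_assoc, mul_assoc, mul_left_comm (Complex.exp _),
      ← Complex.exp_add]; ring_nf

lemma hasDerivAt_modeJet_y (hα : AnalyticAt ℂ α b) (hβ : AnalyticAt ℂ β b)
    (hγ : AnalyticAt ℂ γ b) (hh : AnalyticAt ℂ h b) (k : ℕ) (x y t : ℝ) :
    HasDerivAt (fun s => modeJet α β γ k h b x s t)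
      (modeJet α β γ k (fun b => h b * β b) b x y t) y := by
  have := hasDerivAt_modeJet_x hβ hα hγ hh k y x t
  simpa only [modeJet, add_comm (β _ * _) (α _ * _)] using this

lemma hasDerivAt_modeJet_t (hα : AnalyticAt ℂ α b) (hβ : AnalyticAt ℂ β b)
    (hγ : AnalyticAt ℂ γ b) (hh : AnalyticAt ℂ h b) (k : ℕ) (x y t : ℝ) :
    HasDerivAt (fun s => modeJet α β γ k h b x y s)
      (modeJet α β γ k (fun b => h b * γ b) b x y t) t := by
  have := hasDerivAt_modeJet_x hγ hα hβ hh k t x y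
  simpa only [modeJet, add_assoc, add_comm (γ _ * _)] using this

lemma dx_modeJet (hα : AnalyticAt ℂ α b) (hβ : AnalyticAt ℂ β b)
    (hγ : AnalyticAt ℂ γ b) (hh : AnalyticAt ℂ h b) (k : ℕ) :
    dx (modeJet α β γ k h b) = modeJet α β γ k (fun b => h b * α b) b := by
  funext x y t; exact (hasDerivAt_modeJet_x hα hβ hγ hh k x y t).deriv

lemma dy_modeJet (hα : AnalyticAt ℂ α b) (hβ : AnalyticAt ℂ β b)
    (hγ : AnalyticAt ℂ γ b) (hh : AnalyticAt ℂ h b) (k : ℕ) :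
    dy (modeJet α β γ k h b) = modeJet α β γ k (fun b => h b * β b) b := by
  funext x y t; exact (hasDerivAt_modeJet_y hα hβ hγ hh k x y t).deriv

lemma dt_modeJet (hα : AnalyticAt ℂ α b) (hβ : AnalyticAt ℂ β b)
    (hγ : AnalyticAt ℂ γ b) (hh : AnalyticAt ℂ h b) (k : ℕ) :
    dt (modeJet α β γ k h b) = modeJet α β γ k (fun b => h b * γ b) b := by
  funext x y t; exact (hasDerivAt_modeJet_t hα hβ hγ hh k x y t).deriv

lemma dx_iterate_modeJet (hα : AnalyticAt ℂ α b) (hβ : AnalyticAt ℂ β b)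
    (hγ : AnalyticAt ℂ γ b) (hh : AnalyticAt ℂ h b) (k m : ℕ) :
    dx^[m] (modeJet α β γ k h b) = modeJet α β γ k (fun b => h b * α b ^ m) b := by
  induction m with
  | zero => simp
  | succ m ih =>
    rw [Function.iterate_succ_apply', ih, dx_modeJet hα hβ hγ (by fun_prop)]
    simp only [pow_succ, mul_assoc]

lemma modeJet_add {h₁ h₂ : ℂ → ℂ} (hα : AnalyticAt ℂ α b) (hβ : AnalyticAt ℂ β b)
    (hγ : AnalyticAt ℂ γ b) (hh₁ : AnalyticAt ℂ h₁ b) (hh₂ : AnalyticAt ℂ h₂ b) (k : ℕ)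
    (x y t : ℝ) :
    modeJet α β γ k (fun b => h₁ b + h₂ b) b x y t
      = modeJet α β γ k h₁ b x y t + modeJet α β γ k h₂ b x y t := by
  unfold modeJet
  rw [← iteratedDeriv_add_analytic (by fun_prop) (by fun_prop)]
  simp only [add_mul]

lemma modeJet_const_mul (c : ℂ) (k : ℕ) (x y t : ℝ) :
    modeJet α β γ k (fun b => c * h b) b x y t = c * modeJet α β γ k h b x y t := by
  unfold modeJet
  rw [← iteratedDeriv_const_mul_field]
  simp only [mul_assoc]

/-- One `b`-derivative falls either on the amplitude or on the exponent, where it produces a factor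
linear in `x, y, t`. This recursion makes the jets polynomial up to the exponential. -/
lemma modeJet_succ (hα : AnalyticAt ℂ α b) (hβ : AnalyticAt ℂ β b)
    (hγ : AnalyticAt ℂ γ b) (hh : AnalyticAt ℂ h b) (k : ℕ) (x y t : ℝ) :
    modeJet α β γ (k + 1) h b x y t = modeJet α β γ k (deriv h) b x y t
      + x * modeJet α β γ k (fun b => h b * deriv α b) b x y t
      + y * modeJet α β γ k (fun b => h b * deriv β b) b x y t
      + t * modeJet α β γ k (fun b => h b * deriv γ b) b x y t := by
  have hα' := hα.deriv
  have hβ' := hβ.deriv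
  have hγ' := hγ.deriv
  have hh' := hh.deriv
  simp only [← modeJet_const_mul]
  rw [← modeJet_add hα hβ hγ (by fun_prop) (by fun_prop),
    ← modeJet_add hα hβ hγ (by fun_prop) (by fun_prop),
    ← modeJet_add hα hβ hγ (by fun_prop) (by fun_prop)]
  unfold modeJet
  rw [iteratedDeriv_succ']
  refine (EventuallyEq.iteratedDeriv ?_ k).eq_of_nhds
  filter_upwards [hα.eventually_analyticAt, hβ.eventually_analyticAt, hγ.eventually_analyticAt,
    hh.eventually_analyticAt] with z h1 h2 h3 h4
  have h5 := (((h1.differentiableAt.hasDerivAt.mul_const (x : ℂ)).fun_add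
    (h2.differentiableAt.hasDerivAt.mul_const (y : ℂ))).fun_add
    (h3.differentiableAt.hasDerivAt.mul_const (t : ℂ))).cexp
  rw [(h4.differentiableAt.hasDerivAt.fun_mul h5).deriv]
  ring

/-- The jets of exponential modes are polynomials times the mode. -/
lemma modeJet_eq_exp_mul_eval (hα : AnalyticAt ℂ α b) (hβ : AnalyticAt ℂ β b)
    (hγ : AnalyticAt ℂ γ b) (hh : AnalyticAt ℂ h b) (k : ℕ) :
    ∃ P : MvPolynomial (Fin 3) ℂ, ∀ x y t : ℝ, modeJet α β γ k h b x y t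
      = Complex.exp (α b * x + β b * y + γ b * t)
        * MvPolynomial.eval ![(x : ℂ), (y : ℂ), (t : ℂ)] P := by
  induction k generalizing h with
  | zero => exact ⟨MvPolynomial.C (h b), fun x y t => by simp [modeJet, mul_comm]⟩
  | succ k ih =>
    obtain ⟨P, hP⟩ := ih hh.deriv
    obtain ⟨X, hX⟩ := ih (hh.fun_mul hα.deriv)
    obtain ⟨Y, hY⟩ := ih (hh.fun_mul hβ.deriv)
    obtain ⟨T, hT⟩ := ih (hh.fun_mul hγ.deriv)
    refine ⟨P + MvPolynomial.X 0 * X + MvPolynomial.X 1 * Y + MvPolynomial.X 2 * T,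
      fun x y t => ?_⟩
    rw [modeJet_succ hα hβ hγ hh, hP, hX, hY, hT]
    simp
    ring

end Jets

/-! ### The exponential eigenfunctions of the constant seed. -/

section Eigenfunctions

lemma root_sq (a : ℝ) (b : ℂ) : root a b ^ 2 = (a : ℂ) ^ 2 - b ^ 2 := by
  rw [root, ← Complex.cpow_nat_mul]
  norm_num

lemma analyticAt_root {a : ℝ} (ha : a ≠ 0) (β : ℝ) :
    AnalyticAt ℂ (root a) (Complex.I * β) := by
  -- At `b = iβ` the radicand is `a² + β² > 0`, away from the branch cut.
  have : (a : ℂ) ^ 2 - (Complex.I * β) ^ 2 ∈ Complex.slitPlane := by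
    rw [mul_pow, Complex.I_sq]
    left
    have : 0 < a ^ 2 + β ^ 2 := by positivity
    norm_cast
    simpa using this
  unfold root
  exact AnalyticAt.cpow (by fun_prop) (by fun_prop) this

/-- The jet of the exponential eigenfunctions of the constant seed `a`. -/
noncomputable def seedJet (a β : ℝ) (k : ℕ) (h : ℂ → ℂ) : ℝ → ℝ → ℝ → ℂ :=
  modeJet (fun b => Complex.I * b) (fun b => Complex.I * root a b) (fun b => -2 * b * root a b)
    k h (Complex.I * β)

/-- The ratio `φ / ψ`. -/
noncomputable def seedRatio (a : ℝ) (b : ℂ) : ℂ := (b + root a b * Complex.I) / a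

lemma psiCoeff_eq_seedJet (a β : ℝ) (k : ℕ) (x y t : ℝ) :
    psiCoeff a β k x y t = seedJet a β k (fun _ => 1 / k.factorial) x y t := by
  have := modeJet_const_mul (α := fun b => Complex.I * b) (β := fun b => Complex.I * root a b)
    (γ := fun b => -2 * b * root a b) (h := fun _ => 1) (b := Complex.I * β) (1 / k.factorial)
    k x y t
  simp only [mul_one] at this
  rw [psiCoeff, seedJet, this, modeJet, div_eq_inv_mul, one_div]
  congr 2; funext z
  rw [psi, one_mul]; ring_nf

lemma phiCoeff_eq_seedJet (a β : ℝ) (k : ℕ) (x y t : ℝ) :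
    phiCoeff a β k x y t
      = seedJet a β k (fun b => 1 / k.factorial * seedRatio a b) x y t := by
  rw [phiCoeff, seedJet, modeJet_const_mul, modeJet, div_eq_inv_mul, one_div]
  congr 2; funext z
  rw [phi, seedRatio]; ring_nf

lemma analyticAt_seedRatio {a : ℝ} (ha : a ≠ 0) (β : ℝ) :
    AnalyticAt ℂ (seedRatio a) (Complex.I * β) := by
  have := analyticAt_root ha β
  have h0 : (a : ℂ) ≠ 0 := by exact_mod_cast ha
  unfold seedRatio
  fun_prop (disch := exact h0)

section

/-- Derivatives of jets multiply the amplitude by a symbol in `b`, so a pointwise identity between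
symbols becomes a linear differential equation for the jets. Each line of the Lax pair is obtained
in this way. -/
lemma seedJet_linear {a : ℝ} (ha : a ≠ 0) (β : ℝ) (k : ℕ)
    {h h₁ h₂ : ℂ → ℂ} (hh₁ : AnalyticAt ℂ h₁ (Complex.I * β))
    (hh₂ : AnalyticAt ℂ h₂ (Complex.I * β)) (c₁ c₂ : ℂ)
    (e : ∀ b, h b = c₁ * h₁ b + c₂ * h₂ b) (x y t : ℝ) :
    seedJet a β k h x y t = c₁ * seedJet a β k h₁ x y t + c₂ * seedJet a β k h₂ x y t := by
  have := analyticAt_root ha β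
  rw [funext e]
  simp only [seedJet, ← modeJet_const_mul]
  rw [← modeJet_add (by fun_prop) (by fun_prop) (by fun_prop) (by fun_prop) (by fun_prop)]

lemma dx_iterate_seedJet {a : ℝ} (ha : a ≠ 0) (β : ℝ) (k : ℕ) {h : ℂ → ℂ}
    (hh : AnalyticAt ℂ h (Complex.I * β)) (m : ℕ) :
    dx^[m] (seedJet a β k h) = seedJet a β k (fun b => h b * (Complex.I * b) ^ m) := by
  have := analyticAt_root ha β
  exact dx_iterate_modeJet (by fun_prop) (by fun_prop) (by fun_prop) hh k m

lemma dy_seedJet {a : ℝ} (ha : a ≠ 0) (β : ℝ) (k : ℕ) {h : ℂ → ℂ}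
    (hh : AnalyticAt ℂ h (Complex.I * β)) :
    dy (seedJet a β k h) = seedJet a β k (fun b => h b * (Complex.I * root a b)) := by
  have := analyticAt_root ha β
  exact dy_modeJet (by fun_prop) (by fun_prop) (by fun_prop) hh k

lemma dt_seedJet {a : ℝ} (ha : a ≠ 0) (β : ℝ) (k : ℕ) {h : ℂ → ℂ}
    (hh : AnalyticAt ℂ h (Complex.I * β)) :
    dt (seedJet a β k h) = seedJet a β k (fun b => h b * (-2 * b * root a b)) := by
  have := analyticAt_root ha β
  exact dt_modeJet (by fun_prop) (by fun_prop) (by fun_prop) hh k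

/-- The common exponential factor of the Taylor coefficients of the eigenfunctions. -/
noncomputable def seedExp (a β : ℝ) (x y t : ℝ) : ℂ :=
  Complex.exp (Complex.I * (Complex.I * β) * x + Complex.I * root a (Complex.I * β) * y
    + -2 * (Complex.I * β) * root a (Complex.I * β) * t)

lemma seedJet_eq_seedExp_mul {a : ℝ} (ha : a ≠ 0) (β : ℝ) (k : ℕ) {h : ℂ → ℂ}
    (hh : AnalyticAt ℂ h (Complex.I * β)) :
    ∃ P : MvPolynomial (Fin 3) ℂ, ∀ x y t : ℝ, seedJet a β k h x y t
      = seedExp a β x y t * MvPolynomial.eval ![(x : ℂ), (y : ℂ), (t : ℂ)] P := by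
  have := analyticAt_root ha β
  exact modeJet_eq_exp_mul_eval (by fun_prop) (by fun_prop) (by fun_prop) hh k

end

lemma contDiff_eval (P : MvPolynomial (Fin 3) ℂ) :
    ContDiff ℝ (⊤ : ℕ∞) (fun p : ℝ × ℝ × ℝ =>
      MvPolynomial.eval ![(p.1 : ℂ), (p.2.1 : ℂ), (p.2.2 : ℂ)] P) := by
  have hc : ContDiff ℝ (⊤ : ℕ∞) (fun s : ℝ => (s : ℂ)) := Complex.ofRealCLM.contDiff
  induction P using MvPolynomial.induction_on with
  | C c => simpa using contDiff_const
  | add p q hp hq => simpa using hp.add hq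
  | mul_X p i hp =>
    simp only [map_mul, MvPolynomial.eval_X]
    refine hp.mul ?_
    fin_cases i
    · exact hc.comp contDiff_fst
    · exact hc.comp (contDiff_fst.comp contDiff_snd)
    · exact hc.comp (contDiff_snd.comp contDiff_snd)

lemma contDiff_seedExp (a β : ℝ) :
    ContDiff ℝ (⊤ : ℕ∞) (fun p : ℝ × ℝ × ℝ => seedExp a β p.1 p.2.1 p.2.2) := by
  have hc : ContDiff ℝ (⊤ : ℕ∞) (fun s : ℝ => (s : ℂ)) := Complex.ofRealCLM.contDiff
  unfold seedExp
  have h1 : ContDiff ℝ (⊤ : ℕ∞) (fun p : ℝ × ℝ × ℝ => (p.1 : ℂ)) := hc.comp contDiff_fst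
  have h2 : ContDiff ℝ (⊤ : ℕ∞) (fun p : ℝ × ℝ × ℝ => (p.2.1 : ℂ)) :=
    hc.comp (contDiff_fst.comp contDiff_snd)
  have h3 : ContDiff ℝ (⊤ : ℕ∞) (fun p : ℝ × ℝ × ℝ => (p.2.2 : ℂ)) :=
    hc.comp (contDiff_snd.comp contDiff_snd)
  fun_prop

lemma smoothOn_seedJet {a : ℝ} (ha : a ≠ 0) (β : ℝ) (k : ℕ) {h : ℂ → ℂ}
    (hh : AnalyticAt ℂ h (Complex.I * β)) (Ω : Set (ℝ × ℝ × ℝ)) :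
    SmoothOn Ω (seedJet a β k h) := by
  obtain ⟨P, hP⟩ := seedJet_eq_seedExp_mul ha β k hh
  unfold SmoothOn
  simp only [hP]
  exact ((contDiff_seedExp a β).mul (contDiff_eval P)).contDiffOn

lemma seedRatio_mul {a : ℝ} (ha : a ≠ 0) (b : ℂ) :
    a * seedRatio a b = b + root a b * Complex.I := by
  have h0 : (a : ℂ) ≠ 0 := by exact_mod_cast ha
  rw [seedRatio]; field_simp

/-- Equivalent to `b² + (root a b)² = a²`. With `seedRatio_mul` it contains all the algebra behind
the Lax pair. -/
lemma seedRatio_mul_conj {a : ℝ} (ha : a ≠ 0) (b : ℂ) :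
    seedRatio a b * (b - root a b * Complex.I) = a := by
  have h0 : (a : ℂ) ≠ 0 := by exact_mod_cast ha
  rw [seedRatio]; field_simp
  linear_combination root_sq a b - root a b ^ 2 * Complex.I_sq

section Coefficients

lemma psiCoeff_eq (a β : ℝ) (k : ℕ) : psiCoeff a β k = seedJet a β k (fun _ => 1 / k.factorial) := by
  funext x y t; exact psiCoeff_eq_seedJet a β k x y t

lemma phiCoeff_eq (a β : ℝ) (k : ℕ) :
    phiCoeff a β k = seedJet a β k (fun b => 1 / k.factorial * seedRatio a b) := by
  funext x y t; exact phiCoeff_eq_seedJet a β k x y t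

lemma dx_iterate_psiCoeff {a : ℝ} (ha : a ≠ 0) (β : ℝ) (k : ℕ)
    (m : ℕ) : dx^[m] (psiCoeff a β k)
    = seedJet a β k (fun b => 1 / k.factorial * (Complex.I * b) ^ m) := by
  rw [psiCoeff_eq, dx_iterate_seedJet ha β k (by fun_prop)]

lemma dx_iterate_phiCoeff {a : ℝ} (ha : a ≠ 0) (β : ℝ) (k : ℕ)
    (m : ℕ) : dx^[m] (phiCoeff a β k)
    = seedJet a β k (fun b => 1 / k.factorial * seedRatio a b * (Complex.I * b) ^ m) := by
  have := analyticAt_seedRatio ha β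
  rw [phiCoeff_eq, dx_iterate_seedJet ha β k (by fun_prop)]

lemma dy_dx_iterate_psiCoeff {a : ℝ} (ha : a ≠ 0) (β : ℝ) (k : ℕ)
    (m : ℕ) (x y t : ℝ) : dy (dx^[m] (psiCoeff a β k)) x y t
    = Complex.I * (dx^[m + 1] (psiCoeff a β k)) x y t + a * (dx^[m] (phiCoeff a β k)) x y t := by
  have := analyticAt_seedRatio ha β
  simp only [dx_iterate_psiCoeff ha, dx_iterate_phiCoeff ha]
  rw [dy_seedJet ha β k (by fun_prop)]
  refine seedJet_linear ha β k (by fun_prop) (by fun_prop) _ _ (fun b => ?_) x y t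
  rw [pow_succ]
  linear_combination (1 / k.factorial * (Complex.I * b) ^ m) * (-seedRatio_mul ha b
    - b * Complex.I_sq)

lemma dy_dx_iterate_phiCoeff {a : ℝ} (ha : a ≠ 0) (β : ℝ) (k : ℕ)
    (m : ℕ) (x y t : ℝ) : dy (dx^[m] (phiCoeff a β k)) x y t
    = -Complex.I * (dx^[m + 1] (phiCoeff a β k)) x y t
      + -a * (dx^[m] (psiCoeff a β k)) x y t := by
  have := analyticAt_seedRatio ha β
  simp only [dx_iterate_psiCoeff ha, dx_iterate_phiCoeff ha]
  rw [dy_seedJet ha β k (by fun_prop)]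
  refine seedJet_linear ha β k (by fun_prop) (by fun_prop) _ _ (fun b => ?_) x y t
  rw [pow_succ]
  linear_combination (1 / k.factorial * (Complex.I * b) ^ m) * (-seedRatio_mul_conj ha b
    + b * seedRatio a b * Complex.I_sq)

lemma dt_dx_iterate_psiCoeff {a : ℝ} (ha : a ≠ 0) (β : ℝ) (k : ℕ)
    (m : ℕ) (x y t : ℝ) : dt (dx^[m] (psiCoeff a β k)) x y t
    = 2 * Complex.I * (dx^[m + 2] (psiCoeff a β k)) x y t
      + 2 * a * (dx^[m + 1] (phiCoeff a β k)) x y t := by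
  have := analyticAt_seedRatio ha β
  simp only [dx_iterate_psiCoeff ha, dx_iterate_phiCoeff ha]
  rw [dt_seedJet ha β k (by fun_prop)]
  refine seedJet_linear ha β k (by fun_prop) (by fun_prop) _ _ (fun b => ?_) x y t
  rw [pow_succ, pow_succ]
  linear_combination (1 / k.factorial * (Complex.I * b) ^ m) * (-2 * Complex.I * b *
    seedRatio_mul ha b - (2 * b * root a b + 2 * b ^ 2 * Complex.I) * Complex.I_sq)

lemma dt_dx_iterate_phiCoeff {a : ℝ} (ha : a ≠ 0) (β : ℝ) (k : ℕ)
    (m : ℕ) (x y t : ℝ) : dt (dx^[m] (phiCoeff a β k)) x y t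
    = -2 * Complex.I * (dx^[m + 2] (phiCoeff a β k)) x y t
      + -2 * a * (dx^[m + 1] (psiCoeff a β k)) x y t := by
  have := analyticAt_seedRatio ha β
  simp only [dx_iterate_psiCoeff ha, dx_iterate_phiCoeff ha]
  rw [dt_seedJet ha β k (by fun_prop)]
  refine seedJet_linear ha β k (by fun_prop) (by fun_prop) _ _ (fun b => ?_) x y t
  rw [pow_succ, pow_succ]
  linear_combination (1 / k.factorial * (Complex.I * b) ^ m) * (-2 * Complex.I * b *
    seedRatio_mul_conj ha b + (-2 * b * root a b + 2 * b ^ 2 * Complex.I) * seedRatio a b *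
    Complex.I_sq)

lemma isLaxSolution_coeff {a : ℝ} (ha : a ≠ 0) (β : ℝ) (k : ℕ)
    : IsLaxSolution (fun _ _ _ => (a : ℂ)) (fun _ _ _ => -(a : ℂ))
    (fun _ _ _ => 0) (fun _ _ _ => 0) (psiCoeff a β k) (phiCoeff a β k) := by
  have := analyticAt_seedRatio ha β
  refine ⟨?_, ?_, fun x y t => ⟨?_, ?_, ?_, ?_⟩⟩
  · rw [psiCoeff_eq]; exact smoothOn_seedJet ha β k (by fun_prop) _
  · rw [phiCoeff_eq]; exact smoothOn_seedJet ha β k (by fun_prop) _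
  · exact dy_dx_iterate_psiCoeff ha β k 0 x y t
  · exact dy_dx_iterate_phiCoeff ha β k 0 x y t
  · have := dt_dx_iterate_psiCoeff ha β k 0 x y t
    simp only [Function.iterate_succ_apply', Function.iterate_zero_apply] at this
    rw [this]
    simp [dx, dy]
  · have := dt_dx_iterate_phiCoeff ha β k 0 x y t
    simp only [Function.iterate_succ_apply', Function.iterate_zero_apply] at this
    rw [this]
    simp [dx, dy]

end Coefficients

end Eigenfunctions

/-! ### Dressing operators over a commutative ring with derivations. -/

section Dressing

/-- The sequence `A` moved up by one index, with `0` in front. -/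
def upShift {α : Type*} [Zero α] (A : ℕ → α) : ℕ → α
  | 0 => 0
  | m + 1 => A m

variable {R : Type*} [CommRing R] [Algebra ℂ R] {ι : Type*}

lemma map_derivation_mul {l m o : Type*} [Fintype m] (D : Derivation ℂ R R) (M : Matrix l m R)
    (N : Matrix m o R) : (M * N).map D = M.map D * N + M * N.map D := by
  ext i j
  simp [Matrix.mul_apply, Finset.sum_add_distrib, mul_comm, add_comm]

lemma map_derivation_add {l m : Type*} (D : Derivation ℂ R R) (M N : Matrix l m R) :
    (M + N).map D = M.map D + N.map D := by
  ext i j; simp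

lemma map_derivation_sum {l m κ : Type*} (D : Derivation ℂ R R) (s : Finset κ)
    (M : κ → Matrix l m R) : (∑ k ∈ s, M k).map D = ∑ k ∈ s, (M k).map D := by
  ext i j; simp [Matrix.sum_apply]

lemma map_derivation_zero {l m : Type*} (D : Derivation ℂ R R) :
    (0 : Matrix l m R).map D = 0 := by
  ext i j; simp

lemma map_derivation_one {l : Type*} [DecidableEq l] (D : Derivation ℂ R R) :
    (1 : Matrix l l R).map D = 0 := by
  ext i j; by_cases h : i = j <;> simp [h]

lemma upShift_map_derivation {l m : Type*} (D : Derivation ℂ R R) (A : ℕ → Matrix l m R) (k : ℕ) :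
    (upShift A k).map D = upShift (fun j => (A j).map D) k := by
  cases k
  · exact map_derivation_zero D
  · rfl

omit [Algebra ℂ R] in
-- If `A` holds the coefficients of `L`, then `upShift A` holds those of `L ∂ₓ`. Sums run to order
-- `N + 2`, the highest order in the `t`-equation, and the vanishing of the last coefficient means
-- that nothing is cut off by the shift.
lemma sum_upShift_mul (θ : ℕ → Matrix (Fin 2) ι R) (A : ℕ → Matrix (Fin 2) (Fin 2) R) (N : ℕ)
    (hA : A (N + 2) = 0) :
    ∑ m ∈ Finset.range (N + 3), upShift A m * θ m
      = ∑ m ∈ Finset.range (N + 3), A m * θ (m + 1) := by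
  rw [Finset.sum_range_succ', Finset.sum_range_succ (fun m => A m * θ (m + 1)), hA]
  simp [upShift]

/-- The matrices `A 0, …, A N = 1` are the coefficients of a monic differential operator of order
`N` annihilating `θ 0`, whose `x`-derivatives of order less than `N` are independent. -/
structure IsDressing (N : ℕ) (θ : ℕ → Matrix (Fin 2) ι R)
    (A : ℕ → Matrix (Fin 2) (Fin 2) R) : Prop where
  monic : A N = 1
  vanish : ∀ m, N < m → A m = 0
  annihilates : ∑ m ∈ Finset.range (N + 1), A m * θ m = 0
  independent : ∀ C : ℕ → Matrix (Fin 2) (Fin 2) R,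
    ∑ m ∈ Finset.range N, C m * θ m = 0 → ∀ m < N, C m = 0

variable {N : ℕ} {θ : ℕ → Matrix (Fin 2) ι R} {A : ℕ → Matrix (Fin 2) (Fin 2) R}

omit [Algebra ℂ R] in
lemma IsDressing.sum_eq_zero (h : IsDressing N θ A) :
    ∑ m ∈ Finset.range (N + 3), A m * θ m = 0 := by
  rw [Finset.sum_range_succ, Finset.sum_range_succ, h.annihilates, h.vanish _ (by omega),
    h.vanish _ (by omega)]
  simp

omit [Algebra ℂ R] in
-- The uniqueness principle behind both evolution equations: an operator of order below `N` that
-- kills `θ 0` is zero.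
lemma IsDressing.eq_zero (h : IsDressing N θ A) (C : ℕ → Matrix (Fin 2) (Fin 2) R)
    (hC : ∑ m ∈ Finset.range (N + 3), C m * θ m = 0) (h0 : C N = 0) (h1 : C (N + 1) = 0)
    (h2 : C (N + 2) = 0) (m : ℕ) (hm : m < N) : C m = 0 := by
  refine h.independent C ?_ m hm
  simpa [Finset.sum_range_succ, h0, h1, h2] using hC

lemma IsDressing.sum_dx (h : IsDressing N θ A) (D : Derivation ℂ R R)
    (hx : ∀ m, (θ m).map D = θ (m + 1)) :
    ∑ m ∈ Finset.range (N + 3), (A m).map D * θ m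
      + ∑ m ∈ Finset.range (N + 3), upShift A m * θ m = 0 := by
  have := congrArg (fun M => M.map D) h.sum_eq_zero
  simp only [map_derivation_sum, map_derivation_mul, map_derivation_zero, hx,
    Finset.sum_add_distrib] at this
  rw [sum_upShift_mul θ A N (h.vanish _ (by omega)), this]

/-- The coefficients of `(∂_y - J∂ₓ - U₁) L - L (∂_y - J∂ₓ - U)` form an operator in `∂ₓ` that kills
`θ 0`. Order `N + 1` cancels because `L` is monic, order `N` by the choice of `U₁`, and
`IsDressing.eq_zero` does the rest. -/
theorem IsDressing.dy_eq (h : IsDressing N θ A) (Dx Dy : Derivation ℂ R R)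
    (J U U₁ : Matrix (Fin 2) (Fin 2) R) (hx : ∀ m, (θ m).map Dx = θ (m + 1))
    (hy : ∀ m, (θ m).map Dy = J * θ (m + 1) + U * θ m)
    (hU : U₁ = U + upShift A N * J - J * upShift A N) (m : ℕ) (hm : m < N) :
    (A m).map Dy = J * (A m).map Dx + (J * upShift A m - upShift A m * J) + U₁ * A m
      - A m * U := by
  have e0 := h.sum_eq_zero
  have e1 := h.sum_dx Dx hx
  have e2 := congrArg (fun M => M.map Dy) e0
  simp only [map_derivation_sum, map_derivation_mul, map_derivation_zero, hy,
    Finset.sum_add_distrib, Matrix.mul_add] at e2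
  have e3 := sum_upShift_mul θ (fun m => A m * J) N (by simp [h.vanish (N + 2) (by omega)])
  have e4 : ∀ m, upShift (fun m => A m * J) m = upShift A m * J := by
    intro m; cases m <;> simp [upShift]
  simp only [e4, Matrix.mul_assoc] at e3
  rw [← e3] at e2
  have key := h.eq_zero (fun m => (A m).map Dy - J * (A m).map Dx
    - (J * upShift A m - upShift A m * J) - U₁ * A m + A m * U) ?_ ?_ ?_ ?_ m hm
  · rw [← sub_eq_zero, ← key]; abel
  · simp only [Matrix.add_mul, Matrix.sub_mul, Finset.sum_add_distrib, Finset.sum_sub_distrib, Matrix.mul_assoc,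
      ← Matrix.mul_sum] at e2 ⊢
    rw [e0]
    have e5 := congrArg (fun M => J * M) e1
    simp only [Matrix.mul_add, Matrix.mul_zero, sub_zero] at e5 ⊢
    refine Eq.trans ?_ (sub_eq_zero.2 (e2.trans e5.symm))
    abel
  · simp only [h.monic, map_derivation_one, hU]; simp
  · simp [h.vanish (N + 1) (by omega), upShift, h.monic]
  · simp [h.vanish (N + 1) (by omega), h.vanish (N + 2) (by omega), upShift]

theorem IsDressing.dy_upShift_eq (h : IsDressing N θ A) (Dx Dy : Derivation ℂ R R)
    (J U U₁ : Matrix (Fin 2) (Fin 2) R) (hx : ∀ m, (θ m).map Dx = θ (m + 1))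
    (hy : ∀ m, (θ m).map Dy = J * θ (m + 1) + U * θ m)
    (hU : U₁ = U + upShift A N * J - J * upShift A N) (m : ℕ) (hm : m < N) :
    (upShift A m).map Dy = J * (upShift A m).map Dx
      + (J * upShift (upShift A) m - upShift (upShift A) m * J) + U₁ * upShift A m
      - upShift A m * U := by
  cases m with
  | zero => simp [upShift]
  | succ m => exact h.dy_eq Dx Dy J U U₁ hx hy hU m (by omega)

/-- Same argument for the second-order operator `∂_t - 2J∂ₓ² - 2U∂ₓ`: order `N + 2` cancels by
monicity, order `N + 1` by the choice of `U₁`, order `N` by that of `V₁`. -/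
theorem IsDressing.dt_eq (h : IsDressing N θ A) (Dx Dt : Derivation ℂ R R)
    (J U U₁ V₁ : Matrix (Fin 2) (Fin 2) R) (hx : ∀ m, (θ m).map Dx = θ (m + 1))
    (ht : ∀ m, (θ m).map Dt = 2 • (J * θ (m + 2)) + 2 • (U * θ (m + 1)))
    (hU : U₁ = U + upShift A N * J - J * upShift A N)
    (hV : V₁ = -(2 • (J * (2 • (upShift A N).map Dx + upShift (upShift A) N)))
      - 2 • (U₁ * upShift A N) + 2 • (upShift (upShift A) N * J) + 2 • (upShift A N * U))
    (m : ℕ) (hm : m < N) :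
    (A m).map Dt = 2 • (J * (((A m).map Dx).map Dx + 2 • (upShift A m).map Dx
        + upShift (upShift A) m)) + 2 • (U₁ * ((A m).map Dx + upShift A m)) + V₁ * A m
      - 2 • (upShift (upShift A) m * J) - 2 • (upShift A m * U) := by
  have e0 := h.sum_eq_zero
  have e1 := h.sum_dx Dx hx
  have z1 := h.vanish (N + 1) (by omega)
  have z2 := h.vanish (N + 2) (by omega)
  have e2 := congrArg (fun M => M.map Dx) e1
  simp only [map_derivation_sum, map_derivation_mul, map_derivation_zero, hx,
    Finset.sum_add_distrib, map_derivation_add] at e2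
  have s1 := sum_upShift_mul θ (fun m => (A m).map Dx) N (by simp [z2])
  have s2 := sum_upShift_mul θ (upShift A) N (by simp [upShift, z1])
  rw [← s1, ← s2] at e2
  simp only [← upShift_map_derivation] at e2
  have e3 := congrArg (fun M => M.map Dt) e0
  simp only [map_derivation_sum, map_derivation_mul, map_derivation_zero, ht,
    Finset.sum_add_distrib, Matrix.mul_add, Matrix.mul_smul, ← Finset.smul_sum, ← Matrix.mul_assoc] at e3
  have s3 := sum_upShift_mul θ (fun m => A m * U) N (by simp [z2])
  have s4 := sum_upShift_mul (fun m => θ (m + 1)) (fun m => A m * J) N (by simp [z2])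
  have s5 := sum_upShift_mul θ (upShift fun m => A m * J) N (by simp [upShift, z1])
  have e4 : ∀ (Z : Matrix (Fin 2) (Fin 2) R) m,
      upShift (fun m => A m * Z) m = upShift A m * Z := by
    intro Z m; cases m <;> simp [upShift]
  have e5 : ∀ m, upShift (upShift fun m => A m * J) m = upShift (upShift A) m * J := by
    intro m; cases m
    · simp [upShift]
    · exact e4 J _
  simp only [e4, e5] at s3 s4 s5
  rw [← s3, ← s4, ← s5] at e3
  have key := h.eq_zero (fun m => (A m).map Dt - (2 • (J * (((A m).map Dx).map Dx
        + 2 • (upShift A m).map Dx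
        + upShift (upShift A) m)) + 2 • (U₁ * ((A m).map Dx + upShift A m)) + V₁ * A m
      - 2 • (upShift (upShift A) m * J) - 2 • (upShift A m * U))) ?_ ?_ ?_ ?_ m hm
  · exact sub_eq_zero.1 key
  -- The defect applied to `θ 0` is the `t`-derivative of `Lθ = 0` minus `2J ∂ₓ²`, `2U₁ ∂ₓ` and `V₁`
  -- applied to the same relation.
  · have f0 := congrArg (fun M => V₁ * M) e0
    have f1 := congrArg (fun M => 2 • (U₁ * M)) e1
    have f2 := congrArg (fun M => 2 • (J * M)) e2
    simp only [Matrix.mul_zero, smul_zero] at f0 f1 f2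
    have f : ∀ a b c d : Matrix (Fin 2) ι R, a = 0 → b = 0 → c = 0 → d = 0 →
      a - b - c - d = 0 := by rintro a b c d rfl rfl rfl rfl; simp
    refine Eq.trans ?_ (f _ _ _ _ e3 f2 f1 f0)
    simp only [Matrix.add_mul, Matrix.sub_mul, Matrix.mul_add, Finset.sum_add_distrib, Finset.sum_sub_distrib,
      Matrix.mul_assoc, Matrix.smul_mul, Matrix.mul_smul, ← Finset.smul_sum, ← Matrix.mul_sum, smul_add]
    module
  · simp only [h.monic, map_derivation_one, hV]
    simp
    abel
  · simp only [z1, upShift, h.monic, map_derivation_one, hU, map_derivation_zero]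
    cases N <;> simp [smul_add, smul_sub]
  · simp only [z1, z2, upShift, h.monic, map_derivation_zero]
    simp

/-- The Laplacian factors as `(∂_y + i∂ₓ)(∂_y - i∂ₓ)`, so applied to `(∂_y + i∂ₓ)X` it gives `(∂_y +
i∂ₓ)² m`. -/
lemma laplacian_of_dbar (Dx Dy : Derivation ℂ R R) (hcomm : ∀ f, Dy (Dx f) = Dx (Dy f)) (i : R)
    (hi : i * i = -1) (hDx : Dx i = 0) (hDy : Dy i = 0) (X m : R) (h : Dy X - i * Dx X = m) :
    Dx (Dx (Dy X + i * Dx X)) + Dy (Dy (Dy X + i * Dx X))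
      = Dy (Dy m) - Dx (Dx m) + 2 * i * Dx (Dy m) := by
  subst h
  simp only [map_add, map_sub, Derivation.leibniz, hDx, hDy, smul_eq_mul, mul_zero, add_zero,
    hcomm]
  linear_combination 2 * Dx (Dx (Dy X)) * hi

/-- The Davey-Stewartson system satisfied by the leading coefficient of a dressing operator over a
constant seed `u = -v = a`. -/
theorem IsDressing.davey_stewartson {k : ℕ} (h : IsDressing (k + 1) θ A)
    (Dx Dy Dt : Derivation ℂ R R) (hcomm : ∀ f, Dy (Dx f) = Dx (Dy f)) (i a : R)
    (hi : i * i = -1) (hix : Dx i = 0) (hiy : Dy i = 0) (hit : Dt i = 0)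
    (hax : Dx a = 0) (hay : Dy a = 0) (hat : Dt a = 0)
    (hx : ∀ m, (θ m).map Dx = θ (m + 1))
    (hy : ∀ m, (θ m).map Dy = !![i, 0; 0, -i] * θ (m + 1) + !![0, a; -a, 0] * θ m)
    (ht : ∀ m, (θ m).map Dt = 2 • (!![i, 0; 0, -i] * θ (m + 2))
      + 2 • (!![0, a; -a, 0] * θ (m + 1)))
    (u v Q : R) (hu : u = a - 2 * i * A k 0 1) (hv : v = -a + 2 * i * A k 1 0)
    (hQ : Q = 2 * i * ((Dy (A k 0 0) + i * Dx (A k 0 0)) - (Dy (A k 1 1) - i * Dx (A k 1 1)))) :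
    i * Dt u + Dx (Dx u) - Dy (Dy u) + Q * u = 0 ∧
    Dx (Dx (Q - 2 * (u * v))) + Dy (Dy (Q - 2 * (u * v))) = -4 * Dx (Dx (u * v)) := by
  have hD2 : ∀ D : Derivation ℂ R R, D 2 = 0 := fun D => by
    simpa using D.map_natCast 2
  have hU : !![0, u; v, 0] = !![0, a; -a, 0] + upShift A (k + 1) * !![i, 0; 0, -i]
      - !![i, 0; 0, -i] * upShift A (k + 1) := by
    ext p q; fin_cases p <;> fin_cases q <;>
      simp [upShift, Matrix.mul_apply, Fin.sum_univ_two, Matrix.vecMul, dotProduct, hu, hv] <;> ring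
  have hY := h.dy_eq Dx Dy _ _ _ hx hy hU k (by omega)
  have hY' := h.dy_upShift_eq Dx Dy _ _ _ hx hy hU k (by omega)
  have hT := h.dt_eq Dx Dt _ _ _ _ hx ht hU rfl k (by omega)
  have sh1 : upShift A (k + 1) = A k := rfl
  have sh2 : upShift (upShift A) (k + 1) = upShift A k := rfl
  rw [sh1, sh2] at hT
  simp only [two_smul ℕ] at hT
  have e00 := congrFun (congrFun hY 0) 0
  have e01 := congrFun (congrFun hY 0) 1
  have e11 := congrFun (congrFun hY 1) 1
  have f01 := congrFun (congrFun hY' 0) 1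
  have t01 := congrFun (congrFun hT 0) 1
  clear hY hY' hT hU
  -- `B` and `C` are the coefficients of orders `k - 1` and `k - 2`, read as zero when the order is
  -- negative.
  generalize upShift (upShift A) k = C at *
  generalize upShift A k = B at *
  simp [Matrix.mul_apply, Fin.sum_univ_two, Matrix.vecMul, dotProduct] at e00 e01 e11 f01 t01
  constructor
  · have ex := congrArg Dx e01
    have ey := congrArg Dy e01
    have hux : Dx u = -(2 * i * Dx (A k 0 1)) := by rw [hu]; simp [hix, hax, hD2]
    have huy : Dy u = -(2 * i * Dy (A k 0 1)) := by rw [hu]; simp [hiy, hay, hD2]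
    have hut : Dt u = -(2 * i * Dt (A k 0 1)) := by rw [hu]; simp [hit, hat, hD2]
    have huxx : Dx (Dx u) = -(2 * i * Dx (Dx (A k 0 1))) := by rw [hux]; simp [hix, hD2]
    have huyy : Dy (Dy u) = -(2 * i * Dy (Dy (A k 0 1))) := by rw [huy]; simp [hiy, hD2]
    simp [hix, hiy, hax, hay, hux, huy, hcomm] at ex ey
    rw [huxx, huyy, hut, hQ]
    -- `f01` eliminates `C`, the `x`- and `y`-derivatives of `e01` eliminate the derivatives of `B`,
    -- and the multiples of `e01` and `e00` handle the remaining products.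
    linear_combination 2 * t01 - 4 * f01 + 2 * i * ey - 2 * ex + 4 * A k 1 1 * e01 + 4 * A k 0 1 * e00
      + (2 * i * Dy (A k 0 0) - 2 * Dx (A k 0 0)) * hu
      + (-2 * Dt (A k 0 1) + 2 * u * Dx (A k 0 0) - 4 * A k 0 1 * Dy (A k 0 0)
        + 2 * u * Dx (A k 1 1) - 4 * A k 1 1 * Dy (A k 0 1) + 4 * Dy (B 0 1)
        + 2 * Dx (Dy (A k 0 1))) * hi
  -- The diagonal entries satisfy conjugate d-bar equations with opposite sources `±(uv + a²)`. In
  -- the difference the mixed derivatives cancel, leaving `ΔQ = 2(uv)_yy - 2(uv)_xx`.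
  · have g1 := laplacian_of_dbar Dx Dy hcomm i hi hix hiy (2 * i * A k 0 0) (u * v + a * a) (by
      simp [hix, hiy, hD2, e00, hu, hv]
      ring)
    have g2 := laplacian_of_dbar Dx Dy hcomm (-i) (by simpa using hi) (by simp [hix]) (by simp [hiy])
      (2 * i * A k 1 1) (-(u * v + a * a)) (by
      simp [hix, hiy, hD2, e11, hu, hv]
      ring)
    have hQ' : Q = (Dy (2 * i * A k 0 0) + i * Dx (2 * i * A k 0 0))
        - (Dy (2 * i * A k 1 1) + -i * Dx (2 * i * A k 1 1)) := by
      rw [hQ]; simp [hix, hiy, hD2]; ring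
    have e : ∀ D : Derivation ℂ R R, D (Q - 2 * (u * v)) = D Q - 2 * D (u * v) := by
      intro D; rw [map_sub, Derivation.leibniz, hD2]; simp
    have e' : ∀ D D' : Derivation ℂ R R, D (D' (Q - 2 * (u * v)))
        = D (D' Q) - 2 * D (D' (u * v)) := by
      intro D D'; rw [e, map_sub, Derivation.leibniz, hD2]; simp
    have e2 : ∀ D D' : Derivation ℂ R R, D a = 0 → D' a = 0 →
        D (D' (u * v + a * a)) = D (D' (u * v)) := by
      intro D D' h h'; rw [map_add, map_add, D'.leibniz a a, h']; simp
    simp only [map_neg, e2 Dx Dx hax hax, e2 Dy Dy hay hay, e2 Dx Dy hax hay] at g1 g2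
    rw [e', e', hQ']
    simp only [map_sub]
    linear_combination g1 - g2

end Dressing

/-! ### Smooth functions on an open set as a differential algebra. -/

section SmoothRing

open Filter Topology

/-- The algebra of smooth complex functions on `Ω`. -/
def smoothRing (Ω : Set (ℝ × ℝ × ℝ)) : Subalgebra ℂ (Ω → ℂ) where
  carrier := {f | ∃ g : ℝ × ℝ × ℝ → ℂ, ContDiffOn ℝ (⊤ : ℕ∞) g Ω ∧ ∀ p : Ω, f p = g p}
  mul_mem' := by
    rintro f₁ f₂ ⟨g₁, h₁, e₁⟩ ⟨g₂, h₂, e₂⟩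
    exact ⟨fun p => g₁ p * g₂ p, h₁.mul h₂, fun p => by simp [e₁, e₂]⟩
  add_mem' := by
    rintro f₁ f₂ ⟨g₁, h₁, e₁⟩ ⟨g₂, h₂, e₂⟩
    exact ⟨fun p => g₁ p + g₂ p, h₁.add h₂, fun p => by simp [e₁, e₂]⟩
  algebraMap_mem' c := ⟨fun _ => c, contDiffOn_const, fun _ => rfl⟩

variable {Ω : Set (ℝ × ℝ × ℝ)}

/-- The extension of a function on `Ω` by zero. -/
noncomputable def zeroExtend (f : Ω → ℂ) : ℝ × ℝ × ℝ → ℂ := Function.extend Subtype.val f 0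

lemma zeroExtend_apply (f : Ω → ℂ) (p : Ω) : zeroExtend f p = f p :=
  Subtype.val_injective.extend_apply _ _ _

lemma contDiffOn_zeroExtend (f : smoothRing Ω) : ContDiffOn ℝ (⊤ : ℕ∞) (zeroExtend f.1) Ω := by
  obtain ⟨g, hg, e⟩ := f.2
  exact hg.congr fun p hp => (zeroExtend_apply f.1 ⟨p, hp⟩).trans (e ⟨p, hp⟩)

lemma hasFDerivAt_zeroExtend (hΩ : IsOpen Ω) (f : smoothRing Ω) (p : Ω) :
    HasFDerivAt (zeroExtend f.1) (fderiv ℝ (zeroExtend f.1) p) p :=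
  (((contDiffOn_zeroExtend f).contDiffAt (hΩ.mem_nhds p.2)).differentiableAt
    (by simp)).hasFDerivAt

/-- Derivatives are local and `Ω` is open, so the values chosen off `Ω` do not matter. -/
lemma fderiv_zeroExtend (hΩ : IsOpen Ω) {f : Ω → ℂ} {g : ℝ × ℝ × ℝ → ℂ}
    (h : ∀ p : Ω, f p = g p) (p : Ω) : fderiv ℝ (zeroExtend f) p = fderiv ℝ g p := by
  refine Filter.EventuallyEq.fderiv_eq ?_
  filter_upwards [hΩ.mem_nhds p.2] with q hq
  exact (zeroExtend_apply f ⟨q, hq⟩).trans (h ⟨q, hq⟩)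

/-- The derivative in the direction `v`, as a derivation of the ring of smooth functions. -/
noncomputable def dirDerivation (hΩ : IsOpen Ω) (v : ℝ × ℝ × ℝ) :
    Derivation ℂ (smoothRing Ω) (smoothRing Ω) :=
  Derivation.mk'
    { toFun := fun f => ⟨fun p => fderiv ℝ (zeroExtend f.1) p v,
        fun q => fderiv ℝ (zeroExtend f.1) q v,
        ((contDiffOn_zeroExtend f).fderiv_of_isOpen hΩ (by simp)).clm_apply contDiffOn_const,
        fun _ => rfl⟩
      map_add' := fun f g => by
        ext p
        have h := (hasFDerivAt_zeroExtend hΩ f p).fun_add (hasFDerivAt_zeroExtend hΩ g p)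
        simp only [Subalgebra.coe_add, Pi.add_apply]
        rw [fderiv_zeroExtend hΩ (g := fun q => zeroExtend f.1 q + zeroExtend g.1 q)
          (fun q => by simp [zeroExtend_apply]), h.fderiv]
        rfl
      map_smul' := fun c f => by
        ext p
        have h := (hasFDerivAt_zeroExtend hΩ f p).fun_const_smul c
        simp only [Subalgebra.coe_smul, Pi.smul_apply, RingHom.id_apply]
        rw [fderiv_zeroExtend hΩ (g := fun q => c • zeroExtend f.1 q)
          (fun q => by simp [zeroExtend_apply]), h.fderiv]
        rfl }
    fun f g => by
      ext p
      have h := (hasFDerivAt_zeroExtend hΩ f p).fun_mul (hasFDerivAt_zeroExtend hΩ g p)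
      simp only [LinearMap.coe_mk, AddHom.coe_mk, Subalgebra.coe_add, Subalgebra.coe_mul,
        smul_eq_mul, Pi.add_apply, Pi.mul_apply]
      rw [fderiv_zeroExtend hΩ (g := fun q => zeroExtend f.1 q * zeroExtend g.1 q)
        (fun q => by simp [zeroExtend_apply]), h.fderiv]
      simp [zeroExtend_apply]

lemma dirDerivation_apply (hΩ : IsOpen Ω) (v : ℝ × ℝ × ℝ) (f : smoothRing Ω) (p : Ω) :
    (dirDerivation hΩ v f).1 p = fderiv ℝ (zeroExtend f.1) p v := rfl

lemma two_le_coe_top : (2 : WithTop ℕ∞) ≤ ((⊤ : ℕ∞) : WithTop ℕ∞) :=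
  show ((2 : ℕ∞) : WithTop ℕ∞) ≤ _ from WithTop.coe_le_coe.2 le_top

lemma dirDerivation_comm (hΩ : IsOpen Ω) (v w : ℝ × ℝ × ℝ) (f : smoothRing Ω) :
    dirDerivation hΩ v (dirDerivation hΩ w f) = dirDerivation hΩ w (dirDerivation hΩ v f) := by
  ext p
  have hs := ((contDiffOn_zeroExtend f).contDiffAt (hΩ.mem_nhds p.2)).isSymmSndFDerivAt
    (by simpa using two_le_coe_top)
  have hd : DifferentiableAt ℝ (fderiv ℝ (zeroExtend f.1)) p :=
    (((contDiffOn_zeroExtend f).fderiv_of_isOpen (m := 1) hΩ two_le_coe_top).contDiffAt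
      (hΩ.mem_nhds p.2)).differentiableAt (by simp)
  have key : ∀ v w, (dirDerivation hΩ v (dirDerivation hΩ w f)).1 p
      = fderiv ℝ (fderiv ℝ (zeroExtend f.1)) p v w := by
    intro v w
    rw [dirDerivation_apply, fderiv_zeroExtend hΩ (f := (dirDerivation hΩ w f).1)
      (g := fun q => fderiv ℝ (zeroExtend f.1) q w) (fun q => rfl), fderiv_clm_apply hd (by fun_prop)]
    simp
  rw [key, key]
  exact hs v w

/-- Used to invert the Darboux matrix over the ring itself, so that the dressing coefficients are
automatically smooth. -/
lemma isUnit_smoothRing {f : smoothRing Ω} (hf : ∀ p, f.1 p ≠ 0) : IsUnit f := by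
  refine IsUnit.of_mul_eq_one ⟨fun p => (f.1 p)⁻¹, fun q => (zeroExtend f.1 q)⁻¹,
    (contDiffOn_zeroExtend f).inv fun p hp => ?_, fun p => ?_⟩ ?_
  · rw [zeroExtend_apply f.1 ⟨p, hp⟩]; exact hf _
  · simp only [zeroExtend_apply]
  · ext p
    simp [hf p]

/-- `f` is the restriction of `F` to `Ω`. -/
def IsRestriction (F : ℝ → ℝ → ℝ → ℂ) (f : smoothRing Ω) : Prop :=
  ∀ p : Ω, f.1 p = F p.1.1 p.1.2.1 p.1.2.2

lemma exists_isRestriction {F : ℝ → ℝ → ℝ → ℂ} (hF : SmoothOn Ω F) :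
    ∃ f : smoothRing Ω, IsRestriction F f :=
  ⟨⟨fun p => F p.1.1 p.1.2.1 p.1.2.2, _, hF, fun _ => rfl⟩, fun _ => rfl⟩

variable {F : ℝ → ℝ → ℝ → ℂ} {f : smoothRing Ω}

lemma IsRestriction.ext {g : smoothRing Ω} (hf : IsRestriction F f) (hg : IsRestriction F g) :
    f = g := by
  ext p; rw [hf, hg]

lemma IsRestriction.smoothOn (h : IsRestriction F f) : SmoothOn Ω F :=
  (contDiffOn_zeroExtend f).congr fun p hp =>
    (h ⟨p, hp⟩).symm.trans (zeroExtend_apply f.1 ⟨p, hp⟩).symm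

lemma IsRestriction.deriv_comp (hΩ : IsOpen Ω) (h : IsRestriction F f) (p : Ω)
    {c : ℝ → ℝ × ℝ × ℝ} {v : ℝ × ℝ × ℝ} {s : ℝ} (hc : HasDerivAt c v s) (hp : c s = p) :
    deriv (fun r => F (c r).1 (c r).2.1 (c r).2.2) s = (dirDerivation hΩ v f).1 p := by
  have h1 := hasFDerivAt_zeroExtend hΩ f p
  rw [← hp] at h1
  have h2 := h1.comp_hasDerivAt s hc
  rw [dirDerivation_apply, ← hp, ← h2.deriv]
  refine Filter.EventuallyEq.deriv_eq ?_
  have : Ω ∈ 𝓝 (c s) := hΩ.mem_nhds (hp ▸ p.2)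
  filter_upwards [hc.continuousAt.preimage_mem_nhds this] with r hr
  exact (h ⟨c r, hr⟩).symm.trans (zeroExtend_apply f.1 ⟨c r, hr⟩).symm

lemma IsRestriction.dx (hΩ : IsOpen Ω) (h : IsRestriction F f) :
    IsRestriction (dx F) (dirDerivation hΩ (1, 0, 0) f) := fun p =>
  (h.deriv_comp hΩ p (c := fun s => (s, p.1.2)) (s := p.1.1)
    ((hasDerivAt_id _).prodMk (hasDerivAt_const _ _)) rfl).symm

lemma IsRestriction.dy (hΩ : IsOpen Ω) (h : IsRestriction F f) :
    IsRestriction (dy F) (dirDerivation hΩ (0, 1, 0) f) := fun p =>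
  (h.deriv_comp hΩ p (c := fun s => (p.1.1, s, p.1.2.2)) (s := p.1.2.1)
    ((hasDerivAt_const _ _).prodMk ((hasDerivAt_id _).prodMk (hasDerivAt_const _ _))) rfl).symm

lemma IsRestriction.dt (hΩ : IsOpen Ω) (h : IsRestriction F f) :
    IsRestriction (dt F) (dirDerivation hΩ (0, 0, 1) f) := fun p =>
  (h.deriv_comp hΩ p (c := fun s => (p.1.1, p.1.2.1, s)) (s := p.1.2.2)
    ((hasDerivAt_const _ _).prodMk ((hasDerivAt_const _ _).prodMk (hasDerivAt_id _))) rfl).symm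

end SmoothRing

/-! ### From a linear system to a monic dressing operator. -/

section BlockRows

variable {R : Type*} [CommRing R] {n : ℕ}

/-- The square matrix stacking the first rows of `θ (n - 1), …, θ 0` above their second rows. -/
def stack (n : ℕ) {ι : Type*} (θ : ℕ → Matrix (Fin 2) ι R) : Matrix (Fin n ⊕ Fin n) ι R :=
  Matrix.of (Sum.elim (fun i => θ (n - 1 - (i : ℕ)) 0) (fun i => θ (n - 1 - (i : ℕ)) 1))

/-- The `2 × 2` blocks `C (n - 1), …, C 0` written next to each other. -/
def blockRow (n : ℕ) (C : ℕ → Matrix (Fin 2) (Fin 2) R) : Matrix (Fin 2) (Fin n ⊕ Fin n) R :=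
  Matrix.of fun r => Sum.elim (fun i => C (n - 1 - (i : ℕ)) r 0) (fun i => C (n - 1 - (i : ℕ)) r 1)

lemma sum_mul_eq_blockRow_mul_stack {ι : Type*} (θ : ℕ → Matrix (Fin 2) ι R)
    (C : ℕ → Matrix (Fin 2) (Fin 2) R) :
    ∑ m ∈ Finset.range n, C m * θ m = blockRow n C * stack n θ := by
  ext r j
  rw [← Finset.sum_range_reflect, Finset.sum_range]
  simp [Matrix.sum_apply, Matrix.mul_apply, blockRow, stack, Finset.sum_add_distrib]

lemma blockRow_injOn {C : ℕ → Matrix (Fin 2) (Fin 2) R} (h : blockRow n C = 0) (m : ℕ)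
    (hm : m < n) : C m = 0 := by
  have e : n - 1 - (n - 1 - m) = m := by omega
  ext r s
  have h1 := congrFun (congrFun h r) (Sum.inl ⟨n - 1 - m, by omega⟩)
  have h2 := congrFun (congrFun h r) (Sum.inr ⟨n - 1 - m, by omega⟩)
  simp only [blockRow, Matrix.of_apply, Sum.elim_inl, Sum.elim_inr, Matrix.zero_apply, e] at h1 h2
  fin_cases s
  · exact h1
  · exact h2

/-- The coefficients of the monic operator of order `n` with lower coefficients read off from
the `2 × 2 n` matrix `K`. -/
def monicCoeff (n : ℕ) (K : Matrix (Fin 2) (Fin n ⊕ Fin n) R) (m : ℕ) :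
    Matrix (Fin 2) (Fin 2) R :=
  if h : m < n then
    Matrix.of fun r => ![K r (Sum.inl ⟨n - 1 - m, by omega⟩), K r (Sum.inr ⟨n - 1 - m, by omega⟩)]
  else if m = n then 1 else 0

lemma blockRow_monicCoeff (K : Matrix (Fin 2) (Fin n ⊕ Fin n) R) :
    blockRow n (monicCoeff n K) = K := by
  ext r j
  rcases j with i | i
  all_goals
    have h1 : n - 1 - (i : ℕ) < n := by omega
    have h2 : n - 1 - (n - 1 - (i : ℕ)) = i := by omega
    simp [blockRow, monicCoeff, h1, h2]

/-- Annihilation is the linear system for `K`; independence is invertibility of the stacked matrix.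
-/
lemma isDressing_monicCoeff (θ : ℕ → Matrix (Fin 2) (Fin n ⊕ Fin n) R)
    (hdet : IsUnit (stack n θ).det) {K : Matrix (Fin 2) (Fin n ⊕ Fin n) R}
    (hK : K * stack n θ = -θ n) : IsDressing n θ (monicCoeff n K) where
  monic := by simp [monicCoeff]
  vanish m hm := by simp [monicCoeff, hm.ne', hm.le]
  annihilates := by
    rw [Finset.sum_range_succ, sum_mul_eq_blockRow_mul_stack, blockRow_monicCoeff, hK]
    simp [monicCoeff]
  independent C hC m hm := by
    rw [sum_mul_eq_blockRow_mul_stack] at hC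
    refine blockRow_injOn (n := n) ?_ m hm
    have := congrArg (fun M => M * (stack n θ)⁻¹) hC
    simpa [Matrix.mul_assoc, Matrix.mul_nonsing_inv _ hdet] using this

/-- Cramer's rule for row vectors. -/
lemma apply_mul_det_of_vecMul_eq {ι : Type*} [Fintype ι] [DecidableEq ι] {M : Matrix ι ι R}
    {c b : ι → R} (h : Matrix.vecMul c M = b) (i : ι) : M.det * c i = (M.updateRow i b).det := by
  rw [← Matrix.cramer_transpose_apply, ← h, Matrix.cramer_eq_adjugate_mulVec,
    ← Matrix.mulVec_transpose, Matrix.mulVec_mulVec, Matrix.adjugate_mul]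
  simp [Matrix.smul_mulVec]

end BlockRows

/-! ### Partial derivatives of conjugates, negatives and real functions. -/

section Conjugation

lemma dx_conj (f : ℝ → ℝ → ℝ → ℂ) :
    dx (fun x y t => conj (f x y t)) = fun x y t => conj (dx f x y t) := by
  funext x y t; exact deriv.star

lemma dy_conj (f : ℝ → ℝ → ℝ → ℂ) :
    dy (fun x y t => conj (f x y t)) = fun x y t => conj (dy f x y t) := by
  funext x y t; exact deriv.star

lemma dt_conj (f : ℝ → ℝ → ℝ → ℂ) :
    dt (fun x y t => conj (f x y t)) = fun x y t => conj (dt f x y t) := by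
  funext x y t; exact deriv.star

lemma dx_iterate_conj (f : ℝ → ℝ → ℝ → ℂ) (m : ℕ) :
    dx^[m] (fun x y t => conj (f x y t)) = fun x y t => conj ((dx^[m] f) x y t) := by
  induction m with
  | zero => rfl
  | succ m ih => rw [Function.iterate_succ_apply', ih, dx_conj, Function.iterate_succ_apply']

lemma dx_neg (f : ℝ → ℝ → ℝ → ℂ) : dx (fun x y t => -f x y t) = fun x y t => -dx f x y t := by
  funext x y t; exact deriv.fun_neg

lemma dy_neg (f : ℝ → ℝ → ℝ → ℂ) : dy (fun x y t => -f x y t) = fun x y t => -dy f x y t := by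
  funext x y t; exact deriv.fun_neg

lemma dt_neg (f : ℝ → ℝ → ℝ → ℂ) : dt (fun x y t => -f x y t) = fun x y t => -dt f x y t := by
  funext x y t; exact deriv.fun_neg

lemma deriv_ofReal_comp (f : ℝ → ℝ) (x : ℝ) :
    deriv (fun s => (f s : ℂ)) x = ((deriv f x : ℝ) : ℂ) := by
  by_cases h : DifferentiableAt ℝ f x
  · exact h.hasDerivAt.ofReal_comp.deriv
  -- Without differentiability both sides take the default value `0`.
  · rw [deriv_zero_of_not_differentiableAt h, deriv_zero_of_not_differentiableAt]
    · simp
    · intro h'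
      exact h (by simpa using! Complex.reCLM.differentiableAt.comp x h')

lemma dx_ofReal (f : ℝ → ℝ → ℝ → ℝ) :
    dx (fun x y t => (f x y t : ℂ)) = fun x y t => ((dx f x y t : ℝ) : ℂ) := by
  funext x y t; exact deriv_ofReal_comp _ _

lemma dy_ofReal (f : ℝ → ℝ → ℝ → ℝ) :
    dy (fun x y t => (f x y t : ℂ)) = fun x y t => ((dy f x y t : ℝ) : ℂ) := by
  funext x y t; exact deriv_ofReal_comp _ _

end Conjugation

/-! ### Differential equations for the rows of the Darboux matrix. -/

section Rows

variable {n : ℕ} (ψ φ : Fin n → ℝ → ℝ → ℝ → ℂ)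

lemma upperRow_inl (m : ℕ) (x y t : ℝ) (j : Fin n) :
    upperRow ψ φ m x y t (Sum.inl j) = (dx^[m] (ψ j)) x y t := rfl

lemma lowerRow_inl (m : ℕ) (x y t : ℝ) (j : Fin n) :
    lowerRow ψ φ m x y t (Sum.inl j) = (dx^[m] (φ j)) x y t := rfl

lemma upperRow_inr (m : ℕ) (x y t : ℝ) (j : Fin n) :
    upperRow ψ φ m x y t (Sum.inr j) = conj (lowerRow ψ φ m x y t (Sum.inl j)) := by
  simp [upperRow, lowerRow, dx_iterate_conj]

lemma lowerRow_inr (m : ℕ) (x y t : ℝ) (j : Fin n) :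
    lowerRow ψ φ m x y t (Sum.inr j) = -conj (upperRow ψ φ m x y t (Sum.inl j)) := by
  simp [upperRow, lowerRow, dx_iterate_conj]

lemma dx_upperRow (m : ℕ) (j : Fin n ⊕ Fin n) :
    dx (fun x y t => upperRow ψ φ m x y t j) = fun x y t => upperRow ψ φ (m + 1) x y t j := by
  rcases j with j | j
  · simp only [upperRow_inl, Function.iterate_succ_apply']
  · simp only [upperRow_inr, lowerRow_inl, dx_conj, Function.iterate_succ_apply']

lemma dx_lowerRow (m : ℕ) (j : Fin n ⊕ Fin n) :
    dx (fun x y t => lowerRow ψ φ m x y t j) = fun x y t => lowerRow ψ φ (m + 1) x y t j := by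
  rcases j with j | j
  · simp only [lowerRow_inl, Function.iterate_succ_apply']
  · simp only [lowerRow_inr, upperRow_inl, dx_conj, dx_neg, Function.iterate_succ_apply']

/-- The functions `ψ`, `φ` and their `x`-derivatives solve the Lax pair of the seed
`u = -v = a`. -/
structure IsSeedFamily (a : ℝ) : Prop where
  smooth_psi : ∀ j m, SmoothOn Set.univ (dx^[m] (ψ j))
  smooth_phi : ∀ j m, SmoothOn Set.univ (dx^[m] (φ j))
  dy_psi : ∀ j m x y t, dy (dx^[m] (ψ j)) x y t
    = Complex.I * (dx^[m + 1] (ψ j)) x y t + a * (dx^[m] (φ j)) x y t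
  dy_phi : ∀ j m x y t, dy (dx^[m] (φ j)) x y t
    = -Complex.I * (dx^[m + 1] (φ j)) x y t + -a * (dx^[m] (ψ j)) x y t
  dt_psi : ∀ j m x y t, dt (dx^[m] (ψ j)) x y t
    = 2 * Complex.I * (dx^[m + 2] (ψ j)) x y t + 2 * a * (dx^[m + 1] (φ j)) x y t
  dt_phi : ∀ j m x y t, dt (dx^[m] (φ j)) x y t
    = -2 * Complex.I * (dx^[m + 2] (φ j)) x y t + -2 * a * (dx^[m + 1] (ψ j)) x y t

variable {ψ φ} {a : ℝ} (h : IsSeedFamily ψ φ a)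
include h

/-- For the conjugated columns, the conjugate of the `φ`-equation is the required one because `a` is
real and `v = -u`. -/
lemma IsSeedFamily.dy_upperRow (m : ℕ) (j : Fin n ⊕ Fin n) :
    dy (fun x y t => upperRow ψ φ m x y t j) = fun x y t =>
      Complex.I * upperRow ψ φ (m + 1) x y t j + a * lowerRow ψ φ m x y t j := by
  funext x y t
  rcases j with j | j
  · exact h.dy_psi j m x y t
  · simp only [upperRow_inr, lowerRow_inr, lowerRow_inl, upperRow_inl, dy_conj, h.dy_phi]
    simp

lemma IsSeedFamily.dy_lowerRow (m : ℕ) (j : Fin n ⊕ Fin n) :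
    dy (fun x y t => lowerRow ψ φ m x y t j) = fun x y t =>
      -Complex.I * lowerRow ψ φ (m + 1) x y t j + -a * upperRow ψ φ m x y t j := by
  funext x y t
  rcases j with j | j
  · exact h.dy_phi j m x y t
  · simp only [upperRow_inr, lowerRow_inr, lowerRow_inl, upperRow_inl, dy_conj, dy_neg, h.dy_psi]
    simp
    ring

lemma IsSeedFamily.dt_upperRow (m : ℕ) (j : Fin n ⊕ Fin n) :
    dt (fun x y t => upperRow ψ φ m x y t j) = fun x y t =>
      2 * (Complex.I * upperRow ψ φ (m + 2) x y t j) + 2 * (a * lowerRow ψ φ (m + 1) x y t j) := by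
  funext x y t
  rcases j with j | j
  · exact (h.dt_psi j m x y t).trans (by rw [upperRow_inl, lowerRow_inl]; ring)
  · simp only [upperRow_inr, lowerRow_inr, lowerRow_inl, upperRow_inl, dt_conj, h.dt_phi]
    simp [Complex.conj_ofNat]
    ring

lemma IsSeedFamily.dt_lowerRow (m : ℕ) (j : Fin n ⊕ Fin n) :
    dt (fun x y t => lowerRow ψ φ m x y t j) = fun x y t =>
      2 * (-Complex.I * lowerRow ψ φ (m + 2) x y t j)
        + 2 * (-a * upperRow ψ φ (m + 1) x y t j) := by
  funext x y t
  rcases j with j | j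
  · exact (h.dt_phi j m x y t).trans (by rw [upperRow_inl, lowerRow_inl]; ring)
  · simp only [upperRow_inr, lowerRow_inr, lowerRow_inl, upperRow_inl, dt_conj, dt_neg, h.dt_psi]
    simp [Complex.conj_ofNat]
    ring

lemma IsSeedFamily.smoothOn_upperRow (Ω : Set (ℝ × ℝ × ℝ)) (m : ℕ) (j : Fin n ⊕ Fin n) :
    SmoothOn Ω (fun x y t => upperRow ψ φ m x y t j) := by
  rcases j with j | j
  · exact (h.smooth_psi j m).mono (Set.subset_univ _)
  · simp only [upperRow_inr, lowerRow_inl]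
    exact Complex.conjCLE.contDiff.comp_contDiffOn ((h.smooth_phi j m).mono (Set.subset_univ _))

lemma IsSeedFamily.smoothOn_lowerRow (Ω : Set (ℝ × ℝ × ℝ)) (m : ℕ) (j : Fin n ⊕ Fin n) :
    SmoothOn Ω (fun x y t => lowerRow ψ φ m x y t j) := by
  rcases j with j | j
  · exact (h.smooth_phi j m).mono (Set.subset_univ _)
  · simp only [lowerRow_inr, upperRow_inl]
    exact (Complex.conjCLE.contDiff.comp_contDiffOn
      ((h.smooth_psi j m).mono (Set.subset_univ _))).neg

end Rows

/-! ### The Darboux transform solves the focusing system. -/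

section Solution

variable {n : ℕ} {ψ φ : Fin n → ℝ → ℝ → ℝ → ℂ} {Ω : Set (ℝ × ℝ × ℝ)}

/-- The entries of `θ m` are the restrictions to `Ω` of the upper and lower rows of order `m`. -/
def IsRowRestriction (ψ φ : Fin n → ℝ → ℝ → ℝ → ℂ)
    (θ : ℕ → Matrix (Fin 2) (Fin n ⊕ Fin n) (smoothRing Ω)) : Prop :=
  ∀ m j, IsRestriction (fun x y t => upperRow ψ φ m x y t j) (θ m 0 j) ∧
    IsRestriction (fun x y t => lowerRow ψ φ m x y t j) (θ m 1 j)

lemma IsSeedFamily.exists_isRowRestriction {a : ℝ} (h : IsSeedFamily ψ φ a)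
    (Ω : Set (ℝ × ℝ × ℝ)) :
    ∃ θ : ℕ → Matrix (Fin 2) (Fin n ⊕ Fin n) (smoothRing Ω), IsRowRestriction ψ φ θ := by
  choose U hU using fun m j => exists_isRestriction (h.smoothOn_upperRow Ω m j)
  choose L hL using fun m j => exists_isRestriction (h.smoothOn_lowerRow Ω m j)
  exact ⟨fun m => Matrix.of ![U m, L m], fun m j => ⟨hU m j, hL m j⟩⟩

variable {θ : ℕ → Matrix (Fin 2) (Fin n ⊕ Fin n) (smoothRing Ω)}

lemma IsRowRestriction.dx (hΩ : IsOpen Ω) (hθ : IsRowRestriction ψ φ θ) (m : ℕ) :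
    (θ m).map (dirDerivation hΩ (1, 0, 0)) = θ (m + 1) := by
  ext1 r j
  fin_cases r
  · exact ((hθ m j).1.dx hΩ).ext (by rw [dx_upperRow]; exact (hθ (m + 1) j).1)
  · exact ((hθ m j).2.dx hΩ).ext (by rw [dx_lowerRow]; exact (hθ (m + 1) j).2)

/-- The constants of the ring of smooth functions. -/
noncomputable def ringConst (Ω : Set (ℝ × ℝ × ℝ)) (c : ℂ) : smoothRing Ω := algebraMap ℂ _ c

@[simp]
lemma smoothRing_two_apply (p : Ω) : (2 : smoothRing Ω).1 p = 2 := rfl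

@[simp]
lemma ringConst_apply (c : ℂ) (p : Ω) : (ringConst Ω c).1 p = c := rfl

lemma IsRowRestriction.dy (hΩ : IsOpen Ω) (hθ : IsRowRestriction ψ φ θ) {a : ℝ}
    (h : IsSeedFamily ψ φ a) (m : ℕ) :
    (θ m).map (dirDerivation hΩ (0, 1, 0)) = !![ringConst Ω Complex.I, 0; 0, -ringConst Ω Complex.I] * θ (m + 1)
      + !![0, ringConst Ω a; -ringConst Ω a, 0] * θ m := by
  ext1 r j
  fin_cases r
  · refine ((hθ m j).1.dy hΩ).ext ?_
    rw [h.dy_upperRow]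
    intro p
    simp [Fin.sum_univ_two, Matrix.vecMul, dotProduct, ← (hθ _ j).1 p, ← (hθ _ j).2 p]
  · refine ((hθ m j).2.dy hΩ).ext ?_
    rw [h.dy_lowerRow]
    intro p
    simp [Fin.sum_univ_two, Matrix.vecMul, dotProduct, ← (hθ _ j).1 p, ← (hθ _ j).2 p]

lemma IsRowRestriction.dt (hΩ : IsOpen Ω) (hθ : IsRowRestriction ψ φ θ) {a : ℝ}
    (h : IsSeedFamily ψ φ a) (m : ℕ) :
    (θ m).map (dirDerivation hΩ (0, 0, 1)) = 2 • (!![ringConst Ω Complex.I, 0; 0, -ringConst Ω Complex.I] * θ (m + 2))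
      + 2 • (!![0, ringConst Ω a; -ringConst Ω a, 0] * θ (m + 1)) := by
  ext1 r j
  fin_cases r
  · refine ((hθ m j).1.dt hΩ).ext ?_
    rw [h.dt_upperRow]
    intro p
    simp [two_smul ℕ, Fin.sum_univ_two, Matrix.vecMul, dotProduct, ← (hθ _ j).1 p, ← (hθ _ j).2 p]
    ring
  · refine ((hθ m j).2.dt hΩ).ext ?_
    rw [h.dt_lowerRow]
    intro p
    simp [two_smul ℕ, Fin.sum_univ_two, Matrix.vecMul, dotProduct, ← (hθ _ j).1 p, ← (hθ _ j).2 p]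
    ring

/-- Evaluation at a point of `Ω`. -/
def evalAt (p : Ω) : smoothRing Ω →+* ℂ := (Pi.evalRingHom _ p).comp (smoothRing Ω).val.toRingHom

lemma evalAt_apply (p : Ω) (f : smoothRing Ω) : evalAt p f = f.1 p := rfl

lemma IsRowRestriction.map_stack (hθ : IsRowRestriction ψ φ θ) (p : Ω) :
    (stack n θ).map (evalAt p) = darbouxMatrix ψ φ p.1.1 p.1.2.1 p.1.2.2 := by
  ext i j
  rcases i with i | i
  · exact (hθ _ j).1 p
  · exact (hθ _ j).2 p

lemma IsRowRestriction.isUnit_det (hθ : IsRowRestriction ψ φ θ) (hΩ : Ω ⊆ regularSet ψ φ) :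
    IsUnit (stack n θ).det := by
  refine isUnit_smoothRing fun p => ?_
  rw [← evalAt_apply, RingHom.map_det]
  change ((stack n θ).map (evalAt p)).det ≠ 0
  rw [hθ.map_stack]
  exact hΩ p.2

/-- The entries of the dressing coefficient of order `n - 1` given by Cramer's rule. -/
noncomputable def cramerEntry (ψ φ : Fin n → ℝ → ℝ → ℝ → ℂ) (i : Fin n ⊕ Fin n) (x y t : ℝ) : ℂ :=
  -(((darbouxMatrix ψ φ x y t).updateRow i (upperRow ψ φ n x y t)).det / delta1 ψ φ x y t)

section

variable {K : Matrix (Fin 2) (Fin n ⊕ Fin n) (smoothRing Ω)}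

lemma vecMul_darbouxMatrix (hθ : IsRowRestriction ψ φ θ) (hK : K * stack n θ = -θ n) (p : Ω) :
    Matrix.vecMul (fun j => (K 0 j).1 p) (darbouxMatrix ψ φ p.1.1 p.1.2.1 p.1.2.2)
        = -upperRow ψ φ n p.1.1 p.1.2.1 p.1.2.2 ∧
      Matrix.vecMul (fun j => (K 1 j).1 p) (darbouxMatrix ψ φ p.1.1 p.1.2.1 p.1.2.2)
        = -lowerRow ψ φ n p.1.1 p.1.2.1 p.1.2.2 := by
  have h := congrArg (fun M => M.map (evalAt p)) hK
  simp only [Matrix.map_mul, hθ.map_stack] at h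
  constructor
  · ext j
    refine (congrFun (congrFun h 0) j).trans ?_
    simp only [Matrix.map_apply, Matrix.neg_apply, map_neg, Pi.neg_apply, evalAt_apply]
    rw [(hθ n j).1 p]
  · ext j
    refine (congrFun (congrFun h 1) j).trans ?_
    simp only [Matrix.map_apply, Matrix.neg_apply, map_neg, Pi.neg_apply, evalAt_apply]
    rw [(hθ n j).2 p]

lemma isRestriction_cramerEntry (hθ : IsRowRestriction ψ φ θ) (hΩ : Ω ⊆ regularSet ψ φ)
    (hK : K * stack n θ = -θ n) (i : Fin n ⊕ Fin n) :
    IsRestriction (cramerEntry ψ φ i) (K 0 i) := fun p => by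
  have h := apply_mul_det_of_vecMul_eq (vecMul_darbouxMatrix hθ hK p).1 i
  have h0 : (darbouxMatrix ψ φ p.1.1 p.1.2.1 p.1.2.2).det ≠ 0 := hΩ p.2
  rw [← neg_one_smul ℂ, Matrix.det_updateRow_smul] at h
  rw [cramerEntry, delta1, ← neg_div, eq_div_iff h0, mul_comm, h]
  simp

/-- The rows of the dressing coefficients inherit the conjugation symmetry of the columns. -/
lemma conj_symm (hθ : IsRowRestriction ψ φ θ) (hΩ : Ω ⊆ regularSet ψ φ)
    (hK : K * stack n θ = -θ n) (p : Ω) (i : Fin n) :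
    (K 1 (Sum.inl i)).1 p = -conj ((K 0 (Sum.inr i)).1 p) ∧
      (K 1 (Sum.inr i)).1 p = conj ((K 0 (Sum.inl i)).1 p) := by
  obtain ⟨h0, h1⟩ := vecMul_darbouxMatrix hθ hK p
  set D := darbouxMatrix ψ φ p.1.1 p.1.2.1 p.1.2.2 with hD
  have hdet : D.det ≠ 0 := hΩ p.2
  have h2 : Matrix.vecMul (Sum.elim (fun i => -conj ((K 0 (Sum.inr i)).1 p))
      -- Conjugating the system for the first row and exchanging the two halves of the columns
      -- yields a solution of the system for the second row; a nonzero determinant makes it the only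
      -- one.
      (fun i => conj ((K 0 (Sum.inl i)).1 p))) D = -lowerRow ψ φ n p.1.1 p.1.2.1 p.1.2.2 := by
    ext j
    rcases j with j | j
    · have := congrArg conj (congrFun h0 (Sum.inr j))
      simp [Matrix.vecMul, dotProduct, hD, darbouxMatrix, upperRow_inr, lowerRow_inr] at this ⊢
      rw [← this, add_comm]
    · have := congrArg conj (congrFun h0 (Sum.inl j))
      simp [Matrix.vecMul, dotProduct, hD, darbouxMatrix, upperRow_inr, lowerRow_inr] at this ⊢
      rw [← neg_eq_iff_eq_neg.2 this, add_comm]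
      simp [add_comm]
  have h3 := sub_eq_zero.2 (h1.trans h2.symm)
  rw [← Matrix.sub_vecMul] at h3
  have h4 := sub_eq_zero.1 (Matrix.eq_zero_of_vecMul_eq_zero hdet h3)
  exact ⟨congrFun h4 (Sum.inl i), congrFun h4 (Sum.inr i)⟩

end

variable [NeZero n]

/-- The real potential `S` of the Darboux transform. -/
noncomputable def potential (a : ℝ) (ψ φ : Fin n → ℝ → ℝ → ℝ → ℂ) (x y t : ℝ) : ℝ :=
  2 * ‖uDarboux a ψ φ x y t‖ ^ 2
    - 4 * (dy (cramerEntry ψ φ (Sum.inl 0)) x y t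
        + Complex.I * dx (cramerEntry ψ φ (Sum.inl 0)) x y t).im

lemma ofReal_potential (a : ℝ) (ψ φ : Fin n → ℝ → ℝ → ℝ → ℂ) (x y t : ℝ) :
    (potential a ψ φ x y t : ℂ) = 2 * (uDarboux a ψ φ x y t * conj (uDarboux a ψ φ x y t))
      + 2 * Complex.I * ((dy (cramerEntry ψ φ (Sum.inl 0)) x y t
          + Complex.I * dx (cramerEntry ψ φ (Sum.inl 0)) x y t)
        - conj (dy (cramerEntry ψ φ (Sum.inl 0)) x y t
          + Complex.I * dx (cramerEntry ψ φ (Sum.inl 0)) x y t)) := by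
  rw [Complex.sub_conj, Complex.mul_conj, Complex.normSq_eq_norm_sq, potential]
  push_cast
  linear_combination (-4 * ((dy (cramerEntry ψ φ (Sum.inl 0)) x y t
          + Complex.I * dx (cramerEntry ψ φ (Sum.inl 0)) x y t).im : ℂ)) * Complex.I_sq

/-- Darboux transforms of the constant seed solve the focusing Davey-Stewartson II system. -/
theorem IsSeedFamily.isDSIISolution {a : ℝ} (h : IsSeedFamily ψ φ a)
    (hΩ : IsOpen (regularSet ψ φ)) :
    IsDSIISolution (-1) (regularSet ψ φ) (uDarboux a ψ φ) (potential a ψ φ) := by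
  obtain ⟨θ, hθ⟩ := h.exists_isRowRestriction (regularSet ψ φ)
  have hdet := hθ.isUnit_det subset_rfl
  obtain ⟨K, hK⟩ : ∃ K, K * stack n θ = -θ n :=
    ⟨-θ n * (stack n θ)⁻¹, by rw [Matrix.mul_assoc, Matrix.nonsing_inv_mul _ hdet, Matrix.mul_one]⟩
  obtain ⟨k, rfl⟩ := Nat.exists_eq_succ_of_ne_zero (NeZero.ne n)
  set A := monicCoeff (k + 1) K with hA
  have hdress : IsDressing (k + 1) θ A := isDressing_monicCoeff θ hdet hK
  have hAk : ∀ r, A k r 0 = K r (Sum.inl 0) ∧ A k r 1 = K r (Sum.inr 0) := by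
    intro r; simp [hA, monicCoeff]
  set Dx := dirDerivation hΩ (1, 0, 0)
  set Dy := dirDerivation hΩ (0, 1, 0)
  set Dt := dirDerivation hΩ (0, 0, 1)
  set i := ringConst (regularSet ψ φ) Complex.I with hi
  set α : smoothRing (regularSet ψ φ) := ringConst (regularSet ψ φ) a with hα
  obtain ⟨u, hu⟩ : ∃ u, u = α - 2 * i * A k 0 1 := ⟨_, rfl⟩
  obtain ⟨v, hv⟩ : ∃ v, v = -α + 2 * i * A k 1 0 := ⟨_, rfl⟩
  obtain ⟨Q, hQ⟩ : ∃ Q, Q = 2 * i * ((Dy (A k 0 0) + i * Dx (A k 0 0))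
    - (Dy (A k 1 1) - i * Dx (A k 1 1))) := ⟨_, rfl⟩
  have hds := hdress.davey_stewartson Dx Dy Dt (fun f => dirDerivation_comm hΩ _ _ f) i α
    (Subtype.ext (funext fun _ => Complex.I_mul_I)) (Dx.map_algebraMap _) (Dy.map_algebraMap _)
    (Dt.map_algebraMap _) (Dx.map_algebraMap _) (Dy.map_algebraMap _) (Dt.map_algebraMap _)
    (hθ.dx hΩ) (hθ.dy hΩ h) (hθ.dt hΩ h) u v Q hu hv hQ
  have r11 : IsRestriction (cramerEntry ψ φ (Sum.inl 0)) (A k 0 0) := by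
    rw [(hAk 0).1]; exact isRestriction_cramerEntry hθ subset_rfl hK _
  have r12 : IsRestriction (cramerEntry ψ φ (Sum.inr 0)) (A k 0 1) := by
    rw [(hAk 0).2]; exact isRestriction_cramerEntry hθ subset_rfl hK _
  -- With `A k 1 1` conjugate to `A k 0 0`, `Q` has the form `2i (w - conj w)` and is therefore
  -- real.
  have r22 : IsRestriction (fun x y t => conj (cramerEntry ψ φ (Sum.inl 0) x y t)) (A k 1 1) := by
    intro p
    rw [(hAk 1).2, (conj_symm hθ subset_rfl hK p 0).2, ← (hAk 0).1, r11 p]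
  have ru : IsRestriction (uDarboux a ψ φ) u := by
    intro p
    have := r12 p
    simp only [cramerEntry] at this
    simp [hu, uDarboux, hi, hα, this, delta2]
  have rv : IsRestriction (fun x y t => -conj (uDarboux a ψ φ x y t)) v := by
    intro p
    simp only [← ru p]
    simp [hu, hv, hi, hα, (hAk 1).1, (conj_symm hθ subset_rfl hK p 0).1, (hAk 0).2,
      Complex.conj_ofNat]
    ring
  have rQ : IsRestriction (fun x y t => (potential a ψ φ x y t : ℂ)) (Q - 2 * (u * v)) := by
    intro p
    have e1 := r11.dx hΩ p
    have e2 := r11.dy hΩ p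
    have e3 := r22.dx hΩ p
    have e4 := r22.dy hΩ p
    simp only [dx_conj, dy_conj] at e3 e4
    simp only [ofReal_potential, hQ]
    simp [hi, ru p, rv p, Dx, Dy, e1, e2, e3, e4]
    ring
  have rn : IsRestriction (fun x y t => ((‖uDarboux a ψ φ x y t‖ ^ 2 : ℝ) : ℂ)) (-(u * v)) := by
    intro p
    simp [ru p, rv p, ← Complex.mul_conj']
  refine ⟨ru.smoothOn, Complex.reCLM.contDiff.comp_contDiffOn rQ.smoothOn, fun x y t hp => ⟨?_, ?_⟩⟩
  · have e := congrArg (fun f : smoothRing (regularSet ψ φ) => f.1 ⟨(x, y, t), hp⟩) hds.1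
    have e1 : (Dt u).1 _ = _ := (ru.dt hΩ) ⟨(x, y, t), hp⟩
    have e2 : (Dx (Dx u)).1 _ = _ := ((ru.dx hΩ).dx hΩ) ⟨(x, y, t), hp⟩
    have e3 : (Dy (Dy u)).1 _ = _ := ((ru.dy hΩ).dy hΩ) ⟨(x, y, t), hp⟩
    have e4 := rQ ⟨(x, y, t), hp⟩
    have e5 := rn ⟨(x, y, t), hp⟩
    have e6 := ru ⟨(x, y, t), hp⟩
    simp only [Subalgebra.coe_add, Subalgebra.coe_sub, Subalgebra.coe_mul, Subalgebra.coe_neg,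
      Subalgebra.coe_zero, Pi.add_apply, Pi.sub_apply, Pi.mul_apply, Pi.neg_apply, Pi.zero_apply,
      hi, ringConst_apply, smoothRing_two_apply] at e e1 e2 e3 e4 e5 e6
    rw [e1, e2, e3, e6] at e
    push_cast at e5 ⊢
    linear_combination e - uDarboux a ψ φ x y t * e4 + 2 * uDarboux a ψ φ x y t * e5
  · have e := congrArg (fun f : smoothRing (regularSet ψ φ) => f.1 ⟨(x, y, t), hp⟩) hds.2
    have e1 := ((rQ.dx hΩ).dx hΩ) ⟨(x, y, t), hp⟩
    have e2 := ((rQ.dy hΩ).dy hΩ) ⟨(x, y, t), hp⟩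
    have e3 := ((rn.dx hΩ).dx hΩ) ⟨(x, y, t), hp⟩
    simp only [dx_ofReal, dy_ofReal] at e1 e2 e3
    refine Complex.ofReal_injective ?_
    push_cast
    rw [← e1, ← e2, ← e3, map_neg, map_neg]
    refine e.trans ?_
    have : ∀ f : smoothRing (regularSet ψ φ), (-4 * f).1 ⟨(x, y, t), hp⟩
      = -4 * -1 * (-f).1 ⟨(x, y, t), hp⟩ := fun f => by
        change -4 * f.1 ⟨(x, y, t), hp⟩ = -4 * -1 * -f.1 ⟨(x, y, t), hp⟩
        ring
    exact this _

end Solution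

/-! ### Stability of rational functions. -/

section Rational

variable {Ω : Set (ℝ × ℝ × ℝ)} {f g : ℝ → ℝ → ℝ → ℂ}

lemma IsRationalOn.congr (hf : IsRationalOn Ω f) (e : ∀ x y t, (x, y, t) ∈ Ω → g x y t = f x y t) :
    IsRationalOn Ω g := by
  obtain ⟨P, D, h⟩ := hf
  exact ⟨P, D, fun x y t hp => ⟨(h x y t hp).1, (e x y t hp).trans (h x y t hp).2⟩⟩

lemma IsRationalOn.const (c : ℂ) : IsRationalOn Ω (fun _ _ _ => c) :=
  ⟨MvPolynomial.C c, 1, fun x y t _ => by simp⟩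

lemma IsRationalOn.add (hf : IsRationalOn Ω f) (hg : IsRationalOn Ω g) :
    IsRationalOn Ω (fun x y t => f x y t + g x y t) := by
  obtain ⟨P, D, h⟩ := hf
  obtain ⟨P', D', h'⟩ := hg
  refine ⟨P * D' + D * P', D * D', fun x y t hp => ?_⟩
  obtain ⟨h1, h2⟩ := h x y t hp
  obtain ⟨h3, h4⟩ := h' x y t hp
  simp only [h2, h4, div_add_div _ _ h1 h3]
  simp [h1, h3]

lemma IsRationalOn.mul (hf : IsRationalOn Ω f) (hg : IsRationalOn Ω g) :
    IsRationalOn Ω (fun x y t => f x y t * g x y t) := by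
  obtain ⟨P, D, h⟩ := hf
  obtain ⟨P', D', h'⟩ := hg
  refine ⟨P * P', D * D', fun x y t hp => ?_⟩
  obtain ⟨h1, h2⟩ := h x y t hp
  obtain ⟨h3, h4⟩ := h' x y t hp
  simp only [h2, h4, div_mul_div_comm]
  simp [h1, h3]

lemma IsRationalOn.sub (hf : IsRationalOn Ω f) (hg : IsRationalOn Ω g) :
    IsRationalOn Ω (fun x y t => f x y t - g x y t) :=
  (hf.add ((IsRationalOn.const (-1)).mul hg)).congr fun x y t _ => by ring

lemma eval_map_conj (P : MvPolynomial (Fin 3) ℂ) (x y t : ℝ) :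
    MvPolynomial.eval ![(x : ℂ), (y : ℂ), (t : ℂ)] (MvPolynomial.map (starRingEnd ℂ) P)
      = conj (MvPolynomial.eval ![(x : ℂ), (y : ℂ), (t : ℂ)] P) := by
  have e : ![(x : ℂ), (y : ℂ), (t : ℂ)] = starRingEnd ℂ ∘ ![(x : ℂ), (y : ℂ), (t : ℂ)] := by
    ext i; fin_cases i <;> simp
  rw [MvPolynomial.map_eval, ← e]

lemma IsRationalOn.conj (hf : IsRationalOn Ω f) :
    IsRationalOn Ω (fun x y t => conj (f x y t)) := by
  obtain ⟨P, D, h⟩ := hf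
  refine ⟨MvPolynomial.map (starRingEnd ℂ) P, MvPolynomial.map (starRingEnd ℂ) D,
    fun x y t hp => ?_⟩
  obtain ⟨h1, h2⟩ := h x y t hp
  simp only [h2, eval_map_conj, map_div₀]
  exact ⟨by simpa using h1, trivial⟩

lemma hasDerivAt_eval_curve (P : MvPolynomial (Fin 3) ℂ) (i : Fin 3) {v : ℝ → Fin 3 → ℂ} {s : ℝ}
    (hv : ∀ j, HasDerivAt (fun r => v r j) (Pi.single (M := fun _ => ℂ) i 1 j) s) :
    HasDerivAt (fun r => MvPolynomial.eval (v r) P)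
      (MvPolynomial.eval (v s) (MvPolynomial.pderiv i P)) s := by
  induction P using MvPolynomial.induction_on with
  | C c => simpa using hasDerivAt_const s c
  | add p q hp hq => simpa using hp.fun_add hq
  | mul_X p j hp =>
    simp only [map_mul, MvPolynomial.eval_X, Derivation.leibniz, MvPolynomial.pderiv_X,
      smul_eq_mul, map_add]
    refine (hp.fun_mul (hv j)).congr_deriv ?_
    by_cases h : j = i
    · subst h; simp; ring
    · simp [h]; ring

/-- The quotient rule, with the `x`- and `y`-derivatives treated together. Openness of `Ω` is needed
so that the quotient represents `f` along the curve near the point. -/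
lemma IsRationalOn.deriv_curve (hf : IsRationalOn Ω f) (hΩ : IsOpen Ω) (i : Fin 3)
    (c : ℝ → ℝ → ℝ → ℝ → ℝ × ℝ × ℝ) (s : ℝ → ℝ → ℝ → ℝ) (hs : ∀ x y t, c x y t (s x y t) = (x, y, t))
    (hc : ∀ x y t j, HasDerivAt
      (fun r => ![((c x y t r).1 : ℂ), ((c x y t r).2.1 : ℂ), ((c x y t r).2.2 : ℂ)] j)
      (Pi.single (M := fun _ => ℂ) i 1 j) (s x y t))
    (hcont : ∀ x y t, Continuous (c x y t)) :
    IsRationalOn Ω (fun x y t =>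
      deriv (fun r => f (c x y t r).1 (c x y t r).2.1 (c x y t r).2.2) (s x y t)) := by
  obtain ⟨P, D, h⟩ := hf
  refine ⟨MvPolynomial.pderiv i P * D - P * MvPolynomial.pderiv i D, D ^ 2, fun x y t hp => ?_⟩
  obtain ⟨h1, h2⟩ := h x y t hp
  refine ⟨by simpa using h1, ?_⟩
  have hP := hasDerivAt_eval_curve P i (hc x y t)
  have hD := hasDerivAt_eval_curve D i (hc x y t)
  have h3 := hP.fun_div hD (by rw [hs]; exact h1)
  simp only [hs] at h3
  simp only [map_sub, map_mul, map_pow]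
  rw [← h3.deriv]
  refine Filter.EventuallyEq.deriv_eq ?_
  have : Ω ∈ nhds (c x y t (s x y t)) := hΩ.mem_nhds (by rw [hs]; exact hp)
  filter_upwards [(hcont x y t).continuousAt.preimage_mem_nhds this] with r hr
  exact (h _ _ _ hr).2

lemma IsRationalOn.dx (hf : IsRationalOn Ω f) (hΩ : IsOpen Ω) : IsRationalOn Ω (dx f) := by
  refine hf.deriv_curve hΩ 0 (fun x y t r => (r, y, t)) (fun x _ _ => x) (fun _ _ _ => rfl) ?_
    (fun x y t => by fun_prop)
  intro x y t j
  fin_cases j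
  · simpa using! Complex.ofRealCLM.hasDerivAt (x := x)
  · simpa using! hasDerivAt_const x (y : ℂ)
  · simpa using! hasDerivAt_const x (t : ℂ)

lemma IsRationalOn.dy (hf : IsRationalOn Ω f) (hΩ : IsOpen Ω) : IsRationalOn Ω (dy f) := by
  refine hf.deriv_curve hΩ 1 (fun x y t r => (x, r, t)) (fun _ y _ => y) (fun _ _ _ => rfl) ?_
    (fun x y t => by fun_prop)
  intro x y t j
  fin_cases j
  · simpa using! hasDerivAt_const y (x : ℂ)
  · simpa using! Complex.ofRealCLM.hasDerivAt (x := y)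
  · simpa using! hasDerivAt_const y (t : ℂ)

end Rational

/-! ### Cancellation of exponentials, openness and density. -/

section Polynomial

variable {n : ℕ} {ψ φ : Fin n → ℝ → ℝ → ℝ → ℂ}

/-- The `x`-derivatives of all `ψ j` and `φ j` are polynomials times the nowhere vanishing
function `E`. -/
def HasPolynomialJets (ψ φ : Fin n → ℝ → ℝ → ℝ → ℂ) (E : ℝ → ℝ → ℝ → ℂ) : Prop :=
  (∀ x y t, E x y t ≠ 0) ∧ ∀ j m, ∃ P Q : MvPolynomial (Fin 3) ℂ, ∀ x y t : ℝ,
    (dx^[m] (ψ j)) x y t = E x y t * MvPolynomial.eval ![(x : ℂ), (y : ℂ), (t : ℂ)] P ∧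
    (dx^[m] (φ j)) x y t = E x y t * MvPolynomial.eval ![(x : ℂ), (y : ℂ), (t : ℂ)] Q

variable {E : ℝ → ℝ → ℝ → ℂ}

/-- The common factors of the columns of the Darboux matrix. -/
noncomputable def columnFactor (n : ℕ) (E : ℝ → ℝ → ℝ → ℂ) (x y t : ℝ) : Fin n ⊕ Fin n → ℂ :=
  Sum.elim (fun _ => E x y t) (fun _ => conj (E x y t))

lemma HasPolynomialJets.prod_columnFactor_ne_zero (h : HasPolynomialJets ψ φ E) (x y t : ℝ) :
    ∏ j, columnFactor n E x y t j ≠ 0 := by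
  refine Finset.prod_ne_zero_iff.2 fun j _ => ?_
  rcases j with j | j
  · exact h.1 x y t
  · exact (map_ne_zero _).2 (h.1 x y t)

lemma HasPolynomialJets.exists_rows (h : HasPolynomialJets ψ φ E) :
    ∃ U L : ℕ → Fin n ⊕ Fin n → MvPolynomial (Fin 3) ℂ, ∀ m j (x y t : ℝ),
      upperRow ψ φ m x y t j
        = columnFactor n E x y t j * MvPolynomial.eval ![(x : ℂ), (y : ℂ), (t : ℂ)] (U m j) ∧
      lowerRow ψ φ m x y t j
        = columnFactor n E x y t j * MvPolynomial.eval ![(x : ℂ), (y : ℂ), (t : ℂ)] (L m j) := by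
  choose P Q hPQ using h.2
  refine ⟨fun m => Sum.elim (fun j => P j m) (fun j => MvPolynomial.map (starRingEnd ℂ) (Q j m)),
    fun m => Sum.elim (fun j => Q j m) (fun j => -MvPolynomial.map (starRingEnd ℂ) (P j m)),
    fun m j x y t => ?_⟩
  rcases j with j | j
  · exact hPQ j m x y t
  · simp only [upperRow_inr, lowerRow_inr, upperRow_inl, lowerRow_inl, hPQ, Sum.elim_inr,
      columnFactor, map_neg, eval_map_conj, map_mul, mul_neg, and_self]

lemma det_eq_prod_mul_eval {ι : Type*} [Fintype ι] [DecidableEq ι] {M : Matrix ι ι ℂ} {e : ι → ℂ}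
    {v : Fin 3 → ℂ} {P : Matrix ι ι (MvPolynomial (Fin 3) ℂ)}
    (h : ∀ i j, M i j = e j * MvPolynomial.eval v (P i j)) :
    M.det = (∏ j, e j) * MvPolynomial.eval v P.det := by
  rw [RingHom.map_det, ← Matrix.det_mul_row]
  congr 1
  ext i j
  exact h i j

lemma HasPolynomialJets.exists_delta1 (h : HasPolynomialJets ψ φ E) :
    ∃ Δ : MvPolynomial (Fin 3) ℂ, ∀ x y t : ℝ, delta1 ψ φ x y t
      = (∏ j, columnFactor n E x y t j) * MvPolynomial.eval ![(x : ℂ), (y : ℂ), (t : ℂ)] Δ := by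
  obtain ⟨U, L, hUL⟩ := h.exists_rows
  refine ⟨(Matrix.of (Sum.elim (fun i : Fin n => U (n - 1 - i)) fun i : Fin n => L (n - 1 - i))).det,
    fun x y t => det_eq_prod_mul_eval fun i j => ?_⟩
  rcases i with i | i
  · exact (hUL _ j x y t).1
  · exact (hUL _ j x y t).2

lemma HasPolynomialJets.exists_det_updateRow (h : HasPolynomialJets ψ φ E) (r : Fin n ⊕ Fin n) :
    ∃ Δ : MvPolynomial (Fin 3) ℂ, ∀ x y t : ℝ,
      ((darbouxMatrix ψ φ x y t).updateRow r (upperRow ψ φ n x y t)).det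
      = (∏ j, columnFactor n E x y t j) * MvPolynomial.eval ![(x : ℂ), (y : ℂ), (t : ℂ)] Δ := by
  obtain ⟨U, L, hUL⟩ := h.exists_rows
  refine ⟨((Matrix.of (Sum.elim (fun i : Fin n => U (n - 1 - i))
    fun i : Fin n => L (n - 1 - i))).updateRow r (U n)).det,
    fun x y t => det_eq_prod_mul_eval fun i j => ?_⟩
  by_cases hi : i = r
  · subst hi
    simp only [Matrix.updateRow_self]
    exact (hUL _ j x y t).1
  · simp only [Matrix.updateRow_ne hi]
    rcases i with i | i
    · exact (hUL _ j x y t).1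
    · exact (hUL _ j x y t).2

lemma HasPolynomialJets.isRationalOn_cramerEntry (h : HasPolynomialJets ψ φ E)
    (r : Fin n ⊕ Fin n) : IsRationalOn (regularSet ψ φ) (cramerEntry ψ φ r) := by
  obtain ⟨D, hD⟩ := h.exists_delta1
  obtain ⟨P, hP⟩ := h.exists_det_updateRow r
  refine ⟨-P, D, fun x y t hp => ?_⟩
  have h1 : delta1 ψ φ x y t ≠ 0 := hp
  rw [hD] at h1
  refine ⟨right_ne_zero_of_mul h1, ?_⟩
  rw [cramerEntry, hD, hP, mul_div_mul_left _ _ (left_ne_zero_of_mul h1), map_neg, neg_div]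

lemma HasPolynomialJets.regularSet_eq (h : HasPolynomialJets ψ φ E) :
    ∃ Δ : MvPolynomial (Fin 3) ℂ, regularSet ψ φ = {p : ℝ × ℝ × ℝ |
      MvPolynomial.eval ![(p.1 : ℂ), (p.2.1 : ℂ), (p.2.2 : ℂ)] Δ ≠ 0} := by
  obtain ⟨D, hD⟩ := h.exists_delta1
  refine ⟨D, ?_⟩
  ext p
  simp only [regularSet, hD, Set.mem_ofPred_eq, ne_eq, mul_eq_zero, h.prod_columnFactor_ne_zero,
    false_or]

lemma HasPolynomialJets.isOpen_regularSet (h : HasPolynomialJets ψ φ E) :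
    IsOpen (regularSet ψ φ) := by
  obtain ⟨D, hD⟩ := h.regularSet_eq
  rw [hD]
  exact isOpen_ne_fun (contDiff_eval D).continuous continuous_const

/-- If the regular set missed a neighbourhood of some point, the real-analytic polynomial function
would vanish there, hence everywhere on the connected space. -/
lemma HasPolynomialJets.dense_regularSet (h : HasPolynomialJets ψ φ E)
    (hne : (regularSet ψ φ).Nonempty) : Dense (regularSet ψ φ) := by
  obtain ⟨D, hD⟩ := h.regularSet_eq
  rw [hD] at hne ⊢
  obtain ⟨q, hq⟩ := hne
  by_contra hd
  obtain ⟨p, hp⟩ := not_forall.1 hd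
  have han : AnalyticOnNhd ℝ (fun p : ℝ × ℝ × ℝ =>
      MvPolynomial.eval ![(p.1 : ℂ), (p.2.1 : ℂ), (p.2.2 : ℂ)] D) Set.univ := by
    intro p _
    have hc : ∀ s : ℝ, AnalyticAt ℝ (fun s : ℝ => (s : ℂ)) s :=
      fun s => Complex.ofRealCLM.analyticAt s
    have := AnalyticAt.aeval_mvPolynomial (𝕜 := ℝ) (A := ℂ) (B := ℂ) (z := p)
      (f := fun p : ℝ × ℝ × ℝ => ![(p.1 : ℂ), (p.2.1 : ℂ), (p.2.2 : ℂ)]) ?_ D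
    · simpa [MvPolynomial.coe_aeval_eq_eval] using this
    · intro i
      fin_cases i
      · exact (hc _).comp analyticAt_fst
      · exact (hc _).comp (analyticAt_fst.comp analyticAt_snd)
      · exact (hc _).comp (analyticAt_snd.comp analyticAt_snd)
  refine hq (han.eqOn_zero_of_preconnected_of_eventuallyEq_zero isPreconnected_univ
    (Set.mem_univ p) ?_ (Set.mem_univ q))
  rw [mem_closure_iff_frequently, Filter.not_frequently] at hp
  filter_upwards [hp] with z hz
  simpa using hz

variable [NeZero n]

lemma HasPolynomialJets.isRationalOn_uDarboux (h : HasPolynomialJets ψ φ E) (a : ℝ) :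
    IsRationalOn (regularSet ψ φ) (uDarboux a ψ φ) :=
  ((IsRationalOn.const a).add ((IsRationalOn.const (-(2 * Complex.I))).mul
    (h.isRationalOn_cramerEntry (Sum.inr 0)))).congr fun x y t _ => by
      simp [uDarboux, cramerEntry, delta2]

lemma HasPolynomialJets.isRationalOn_potential (h : HasPolynomialJets ψ φ E) (a : ℝ) :
    IsRationalOn (regularSet ψ φ) (fun x y t => (potential a ψ φ x y t : ℂ)) := by
  have hΩ := h.isOpen_regularSet
  have hu := h.isRationalOn_uDarboux a
  have hc := h.isRationalOn_cramerEntry (Sum.inl 0)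
  have hg := (hc.dy hΩ).add ((IsRationalOn.const Complex.I).mul (hc.dx hΩ))
  exact (((IsRationalOn.const 2).mul (hu.mul hu.conj)).add
    ((IsRationalOn.const (2 * Complex.I)).mul (hg.sub hg.conj))).congr
      fun x y t _ => ofReal_potential a ψ φ x y t

end Polynomial

/-! ### Asymptotics on the line `y = t = 0` and the limiting determinant. -/

section NonVanishing

open Filter Topology

lemma iteratedDeriv_succ_sub_mul {g : ℂ → ℂ} {b : ℂ} (c : ℂ) (hg : AnalyticAt ℂ g b) (k : ℕ) :
    iteratedDeriv (k + 1) (fun z => (z - c) * g z) b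
      = (b - c) * iteratedDeriv (k + 1) g b + (k + 1) * iteratedDeriv k g b := by
  induction k generalizing g with
  | zero =>
    have h := ((hasDerivAt_id' b).sub_const c).fun_mul hg.differentiableAt.hasDerivAt
    simp only [zero_add, iteratedDeriv_one, iteratedDeriv_zero]
    rw [h.deriv]
    simp
    ring
  | succ k ih =>
    have e : deriv (fun z => (z - c) * g z) =ᶠ[𝓝 b] fun z => g z + (z - c) * deriv g z := by
      filter_upwards [hg.eventually_analyticAt] with z hz
      have h := ((hasDerivAt_id' z).sub_const c).fun_mul hz.differentiableAt.hasDerivAt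
      rw [h.deriv]
      simp
    have hg' := hg.deriv
    rw [iteratedDeriv_succ', (e.iteratedDeriv (k + 1)).eq_of_nhds,
      iteratedDeriv_add_analytic hg (by fun_prop), ih hg',
      iteratedDeriv_succ' (n := k + 1) (f := g), iteratedDeriv_succ' (n := k) (f := g)]
    push_cast
    ring

/-- Up to the exponential the jet is a polynomial in `s` of degree at most `k`; its `s^k` term
arises when all `k` derivatives fall on the exponent. -/
lemma tendsto_lineJet {α h : ℂ → ℂ} {b : ℂ} (hα : AnalyticAt ℂ α b) (hh : AnalyticAt ℂ h b)
    (k : ℕ) :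
    Tendsto (fun s : ℝ => ((s : ℂ) ^ k)⁻¹ * (Complex.exp (-(α b * s)) * lineJet α k h b s)) atTop
      (𝓝 (h b * deriv α b ^ k)) := by
  induction k generalizing h with
  | zero =>
    refine tendsto_const_nhds.congr fun s => ?_
    rw [lineJet, iteratedDeriv_zero, mul_left_comm (Complex.exp _), ← Complex.exp_add]
    simp
  | succ k ih =>
    have h0 : Tendsto (fun s : ℝ => ((s : ℂ))⁻¹) atTop (𝓝 0) := by
      have := (Complex.continuous_ofReal.tendsto 0).comp tendsto_inv_atTop_zero
      simpa [Function.comp_def] using this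
    have h1 := (h0.mul (ih hh.deriv)).add (ih (hh.fun_mul hα.deriv))
    simp only [zero_mul, zero_add] at h1
    rw [pow_succ' (deriv α b), ← mul_assoc]
    refine h1.congr' ?_
    filter_upwards [eventually_ne_atTop 0] with s hs
    have hs' : (s : ℂ) ≠ 0 := by exact_mod_cast hs
    rw [lineJet_succ hα hh]
    field_simp
    ring

variable {a : ℝ} (ha : a ≠ 0) (β : ℝ)

lemma seedJet_axis (k : ℕ) (h : ℂ → ℂ) (x : ℝ) :
    seedJet a β k h x 0 0 = lineJet (fun b => Complex.I * b) k h (Complex.I * β) x := by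
  simp [seedJet, modeJet, lineJet]

/-- The factor `I * b + β` lowers the order of the Taylor coefficient at `b = I * β`. -/
lemma lineJet_succ_mul_factor {h : ℂ → ℂ} (hh : AnalyticAt ℂ h (Complex.I * β)) (k : ℕ) (x : ℝ) :
    lineJet (fun b => Complex.I * b) (k + 1) (fun b => h b * (Complex.I * b + β)) (Complex.I * β) x
      = Complex.I * (k + 1) * lineJet (fun b => Complex.I * b) k h (Complex.I * β) x := by
  have e : (fun b => h b * (Complex.I * b + β) * Complex.exp (Complex.I * b * x))
      = fun b => Complex.I * ((b - Complex.I * β) * (h b * Complex.exp (Complex.I * b * x))) := by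
    funext b
    linear_combination (h b * Complex.exp (Complex.I * b * x) * β) * Complex.I_sq
  unfold lineJet
  rw [e, iteratedDeriv_const_mul_field, iteratedDeriv_succ_sub_mul _ (by fun_prop)]
  ring

/-- The symbol `(ib + β)^l` of `(∂ₓ + β)^l` vanishes to order `l` at `b = iβ`. It lowers the degree
in `x` from `k` to `k - l` and contributes a falling factorial, which is zero when `l > k`. -/
lemma tendsto_lineJet_factor {h : ℂ → ℂ} (hh : AnalyticAt ℂ h (Complex.I * β)) (k l : ℕ) :
    Tendsto (fun x : ℝ => (x : ℂ) ^ l * (((x : ℂ) ^ k)⁻¹ * (Complex.exp (β * x)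
        * lineJet (fun b => Complex.I * b) k (fun b => h b * (Complex.I * b + β) ^ l)
          (Complex.I * β) x))) atTop
      (𝓝 (h (Complex.I * β) * Complex.I ^ k * k.descFactorial l)) := by
  induction l generalizing k with
  | zero =>
    have hd : deriv (fun b => Complex.I * b) (Complex.I * β) = Complex.I := by
      simp
    have := tendsto_lineJet (α := fun b => Complex.I * b) (by fun_prop) hh k
    rw [hd] at this
    have e : ∀ x : ℝ, -(Complex.I * (Complex.I * β) * x) = β * x := fun x => by
      linear_combination (-(β : ℂ) * x) * Complex.I_sq
    simpa [e] using this
  | succ l ih =>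
    have e : (fun b : ℂ => h b * (Complex.I * b + β) ^ (l + 1))
        = fun b => (h b * (Complex.I * b + β) ^ l) * (Complex.I * b + β) := by
      funext b; ring
    rw [e]
    cases k with
    | zero =>
      have : Complex.I * (Complex.I * β) + β = 0 := by linear_combination β * Complex.I_sq
      simp [lineJet, this]
    | succ k =>
      have h1 := (ih k).const_mul (Complex.I * (k + 1))
      have e2 : h (Complex.I * β) * Complex.I ^ (k + 1) * (k + 1).descFactorial (l + 1)
          = Complex.I * (k + 1) * (h (Complex.I * β) * Complex.I ^ k * k.descFactorial l) := by
        rw [Nat.succ_descFactorial_succ]; push_cast; ring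
      rw [e2]
      refine h1.congr' ?_
      filter_upwards [eventually_ne_atTop 0] with s hs
      have hs' : (s : ℂ) ≠ 0 := by exact_mod_cast hs
      rw [lineJet_succ_mul_factor β (by fun_prop)]
      field_simp
      ring

include ha in
lemma seedJet_sum {ι : Type*} (s : Finset ι) (k : ℕ) (c : ι → ℂ) (h : ι → ℂ → ℂ)
    (hh : ∀ i ∈ s, AnalyticAt ℂ (h i) (Complex.I * β)) (x y t : ℝ) :
    seedJet a β k (fun b => ∑ i ∈ s, c i * h i b) x y t
      = ∑ i ∈ s, c i * seedJet a β k (h i) x y t := by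
  classical
  induction s using Finset.induction_on with
  | empty => simp [seedJet, modeJet]
  | insert i s hi ih =>
    have h1 := fun j hj => hh j (Finset.mem_insert_of_mem hj)
    rw [Finset.sum_insert hi, ← ih h1]
    have := seedJet_linear ha β k (h := fun b => ∑ i ∈ insert i s, c i * h i b)
      (hh i (Finset.mem_insert_self i s))
      (h₂ := fun b => ∑ i ∈ s, c i * h i b)
      (Finset.analyticAt_fun_sum _ fun j hj => analyticAt_const.fun_mul (h1 j hj)) (c i) 1
      (fun b => by rw [Finset.sum_insert hi, one_mul]) x y t
    rw [this, one_mul]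

/-- The coefficients expressing `(∂ₓ + β) ^ l` through powers of `∂ₓ`. -/
noncomputable def shiftCoeff (β : ℝ) (l m : ℕ) : ℂ := (β : ℂ) ^ (l - m) * l.choose m

include ha in
lemma sum_shiftCoeff_seedJet {n : ℕ} (k : ℕ) {h : ℂ → ℂ} (hh : AnalyticAt ℂ h (Complex.I * β))
    {l : ℕ} (hl : l < n) (x : ℝ) :
    ∑ m ∈ Finset.range n, shiftCoeff β l m
        * seedJet a β k (fun b => h b * (Complex.I * b) ^ m) x 0 0
      = lineJet (fun b => Complex.I * b) k (fun b => h b * (Complex.I * b + β) ^ l)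
          (Complex.I * β) x := by
  rw [← seedJet_sum ha β _ k (shiftCoeff β l) (fun m b => h b * (Complex.I * b) ^ m)
    (fun m _ => by fun_prop), seedJet_axis]
  congr 1
  funext b
  rw [add_pow, Finset.mul_sum]
  refine (Finset.sum_subset (Finset.range_subset_range.2 hl) fun m _ hm => ?_).symm.trans
    (Finset.sum_congr rfl fun m _ => ?_)
  · rw [shiftCoeff, Nat.choose_eq_zero_of_lt (by simpa using hm)]
    simp
  · rw [shiftCoeff]; ring

/-- Falling factorials are monic polynomials of degree `l` in `k_j`, so row operations reduce the
determinant to a Vandermonde determinant, nonzero for distinct `k_j`. -/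
lemma det_descFactorial_ne_zero {n : ℕ} {k : Fin n → ℕ} (hk : Function.Injective k)
    {e : Fin n → ℂ} (he : ∀ j, e j ≠ 0) :
    (Matrix.of fun l j : Fin n => e j * ((k j).descFactorial l : ℂ)).det ≠ 0 := by
  have h1 := Matrix.det_eval_matrixOfPolynomials_eq_det_vandermonde (fun j => (k j : ℂ))
    (fun l : Fin n => descPochhammer ℂ l) (fun l => descPochhammer_natDegree _ _)
    (fun l => monic_descPochhammer _ _)
  have h2 := Matrix.det_mul_row e (Matrix.of fun l j : Fin n => ((k j).descFactorial l : ℂ))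
  simp only [Matrix.of_apply] at h2
  rw [h2]
  refine mul_ne_zero (Finset.prod_ne_zero_iff.2 fun j _ => he j) ?_
  rw [← Matrix.det_transpose]
  have h3 : (Matrix.of fun l j : Fin n => ((k j).descFactorial l : ℂ)).transpose
      = Matrix.of fun i j : Fin n => (descPochhammer ℂ (j : ℕ)).eval (k i : ℂ) := by
    ext i j
    simp [descPochhammer_eval_eq_descFactorial]
  rw [h3, ← h1, Matrix.det_vandermonde_ne_zero_iff]
  exact Nat.cast_injective.comp hk

/-- Quaternionic block matrices with proportional columns are nonsingular. -/
lemma det_fromBlocks_conj_ne_zero {n : ℕ} {X : Matrix (Fin n) (Fin n) ℂ} (hX : X.det ≠ 0) (c : ℂ) :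
    (Matrix.fromBlocks X (conj c • X.map conj) (c • X) (-X.map conj)).det ≠ 0 := by
  have hX' : (X.map conj).det ≠ 0 := by
    have : (X.map conj).det = conj X.det := (RingHom.map_det (starRingEnd ℂ) X).symm
    rw [this]
    exact (map_ne_zero _).2 hX
  -- Eliminating one block leaves the factor `1 + |c|²`, which is positive.
  have hc : 1 + c * conj c ≠ 0 := by
    rw [Complex.mul_conj]
    norm_cast
    have := Complex.normSq_nonneg c
    positivity
  rw [Ne, ← Matrix.exists_mulVec_eq_zero_iff]
  rintro ⟨v, hv0, hv⟩
  apply hv0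
  rw [Matrix.fromBlocks_mulVec] at hv
  have h1 := fun i => congrFun hv (Sum.inl i)
  have h2 := fun i => congrFun hv (Sum.inr i)
  simp only [Sum.elim_inl, Sum.elim_inr, Matrix.smul_mulVec, Matrix.neg_mulVec, Pi.add_apply,
    Pi.smul_apply, Pi.neg_apply, Pi.zero_apply, smul_eq_mul] at h1 h2
  have h3 : Matrix.mulVec (X.map conj) (v ∘ Sum.inr) = 0 := by
    ext i
    refine (mul_eq_zero.1 ?_).resolve_left hc
    linear_combination c * h1 i - h2 i
  have h4 : Matrix.mulVec X (v ∘ Sum.inl) = 0 := by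
    ext i
    have := h1 i
    rw [h3] at this
    simpa using this
  have h5 := Matrix.eq_zero_of_mulVec_eq_zero hX h4
  have h6 := Matrix.eq_zero_of_mulVec_eq_zero hX' h3
  ext (i | i)
  · exact congrFun h5 i
  · exact congrFun h6 i

end NonVanishing

/-! ### A point where `δ₁` does not vanish. -/

section NonEmpty

open Filter Topology

variable {a : ℝ} (ha : a ≠ 0) (β : ℝ) {n : ℕ} (k : Fin n → ℕ)

/-- The Taylor coefficients of the exponential eigenfunctions. -/
noncomputable def psiFamily (a β : ℝ) (k : Fin n → ℕ) (j : Fin n) : ℝ → ℝ → ℝ → ℂ :=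
  psiCoeff a β (k j)

/-- The Taylor coefficients of the second components of the exponential eigenfunctions. -/
noncomputable def phiFamily (a β : ℝ) (k : Fin n → ℕ) (j : Fin n) : ℝ → ℝ → ℝ → ℂ :=
  phiCoeff a β (k j)

/-- The upper rows of `(∂ₓ + β) ^ l` applied to the eigenfunctions on the line `y = t = 0`. -/
noncomputable def shiftedUpper (a β : ℝ) (k : Fin n → ℕ) (l : ℕ) (x : ℝ) (j : Fin n ⊕ Fin n) : ℂ :=
  ∑ m ∈ Finset.range n, shiftCoeff β l m
    * upperRow (psiFamily a β k) (phiFamily a β k) m x 0 0 j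

/-- The lower rows of `(∂ₓ + β) ^ l` applied to the eigenfunctions on the line `y = t = 0`. -/
noncomputable def shiftedLower (a β : ℝ) (k : Fin n → ℕ) (l : ℕ) (x : ℝ) (j : Fin n ⊕ Fin n) : ℂ :=
  ∑ m ∈ Finset.range n, shiftCoeff β l m
    * lowerRow (psiFamily a β k) (phiFamily a β k) m x 0 0 j

lemma conj_shiftCoeff (l m : ℕ) : conj (shiftCoeff β l m) = shiftCoeff β l m := by
  simp [shiftCoeff]

lemma shiftedUpper_inr (l : ℕ) (x : ℝ) (j : Fin n) :
    shiftedUpper a β k l x (Sum.inr j) = conj (shiftedLower a β k l x (Sum.inl j)) := by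
  simp only [shiftedUpper, shiftedLower, upperRow_inr, map_sum, map_mul, conj_shiftCoeff]

lemma shiftedLower_inr (l : ℕ) (x : ℝ) (j : Fin n) :
    shiftedLower a β k l x (Sum.inr j) = -conj (shiftedUpper a β k l x (Sum.inl j)) := by
  simp only [shiftedUpper, shiftedLower, lowerRow_inr, map_sum, map_mul, conj_shiftCoeff, mul_neg,
    Finset.sum_neg_distrib]

/-- The scaling factor of an entry of the Darboux matrix in a row of order `l` and a column of
degree `k`. -/
noncomputable def scaleFactor (β : ℝ) (k l : ℕ) (x : ℝ) : ℂ :=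
  (x : ℂ) ^ l * (((x : ℂ) ^ k)⁻¹ * Complex.exp (β * x))

/-- The scaling is real, so the limits for the conjugated columns follow by conjugation. -/
lemma conj_scaleFactor (k l : ℕ) (x : ℝ) : conj (scaleFactor β k l x) = scaleFactor β k l x := by
  simp [scaleFactor, ← Complex.exp_conj]

/-- The limits of the scaled upper left entries of the Darboux matrix. -/
noncomputable def limitEntry (k l : ℕ) : ℂ :=
  1 / k.factorial * Complex.I ^ k * k.descFactorial l

include ha

lemma tendsto_shiftedUpper_inl (l : ℕ) (hl : l < n) (j : Fin n) :
    Tendsto (fun x => scaleFactor β (k j) l x * shiftedUpper a β k l x (Sum.inl j)) atTop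
      (𝓝 (limitEntry (k j) l)) := by
  have h1 := tendsto_lineJet_factor β (h := fun _ => 1 / ((k j).factorial : ℂ)) (by fun_prop)
    (k j) l
  refine h1.congr fun x => ?_
  rw [← sum_shiftCoeff_seedJet ha β (k j) (by fun_prop) hl, scaleFactor, shiftedUpper]
  simp only [upperRow_inl, psiFamily, dx_iterate_psiCoeff ha, mul_assoc]

lemma tendsto_shiftedLower_inl (l : ℕ) (hl : l < n) (j : Fin n) :
    Tendsto (fun x => scaleFactor β (k j) l x * shiftedLower a β k l x (Sum.inl j)) atTop
      (𝓝 (seedRatio a (Complex.I * β) * limitEntry (k j) l)) := by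
  have hr := analyticAt_seedRatio ha β
  have h1 := tendsto_lineJet_factor β
    (h := fun b => 1 / ((k j).factorial : ℂ) * seedRatio a b) (by fun_prop) (k j) l
  have e : seedRatio a (Complex.I * β) * limitEntry (k j) l = 1 / ((k j).factorial : ℂ)
      * seedRatio a (Complex.I * β) * Complex.I ^ (k j) * (k j).descFactorial l := by
    rw [limitEntry]; ring
  rw [e]
  refine h1.congr fun x => ?_
  rw [← sum_shiftCoeff_seedJet ha β (k j) (by fun_prop) hl, scaleFactor, shiftedLower]
  simp only [lowerRow_inl, phiFamily, dx_iterate_phiCoeff ha, mul_assoc]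

lemma tendsto_shiftedUpper_inr (l : ℕ) (hl : l < n) (j : Fin n) :
    Tendsto (fun x => scaleFactor β (k j) l x * shiftedUpper a β k l x (Sum.inr j)) atTop
      (𝓝 (conj (seedRatio a (Complex.I * β)) * conj (limitEntry (k j) l))) := by
  rw [← map_mul]
  refine ((Complex.continuous_conj.tendsto _).comp
    (tendsto_shiftedLower_inl ha β k l hl j)).congr fun x => ?_
  rw [shiftedUpper_inr, Function.comp, map_mul, conj_scaleFactor]

lemma tendsto_shiftedLower_inr (l : ℕ) (hl : l < n) (j : Fin n) :
    Tendsto (fun x => scaleFactor β (k j) l x * shiftedLower a β k l x (Sum.inr j)) atTop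
      (𝓝 (-conj (limitEntry (k j) l))) := by
  refine ((Complex.continuous_conj.tendsto _).comp
    (tendsto_shiftedUpper_inl ha β k l hl j)).neg.congr fun x => ?_
  rw [shiftedLower_inr, Function.comp, map_mul, conj_scaleFactor, mul_neg]

theorem regularSet_nonempty (hk : Function.Injective k) :
    (regularSet (psiFamily a β k) (phiFamily a β k)).Nonempty := by
  set X : Matrix (Fin n) (Fin n) ℂ := Matrix.of fun l j => limitEntry (k j) l with hX
  have hXdet : X.det ≠ 0 := det_descFactorial_ne_zero hk fun j => by
    have : ((k j).factorial : ℂ) ≠ 0 := by exact_mod_cast (k j).factorial_ne_zero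
    simp [this]
  set c := seedRatio a (Complex.I * β)
  let T : ℝ → Matrix (Fin n ⊕ Fin n) (Fin n ⊕ Fin n) ℂ := fun x => Matrix.of
    (Sum.elim (fun l => shiftedUpper a β k l x) (fun l => shiftedLower a β k l x))
  -- The scaling splits into a row factor `x^l` and a column factor `x^(-k_j) e^(βx)`, so it only
  -- multiplies the determinant by scalars.
  let r : ℝ → Fin n ⊕ Fin n → ℂ := fun x => Sum.elim (fun l => (x : ℂ) ^ (l : ℕ))
    (fun l => (x : ℂ) ^ (l : ℕ))
  let s : ℝ → Fin n ⊕ Fin n → ℂ := fun x => Sum.elim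
    (fun j => ((x : ℂ) ^ k j)⁻¹ * Complex.exp (β * x))
    (fun j => ((x : ℂ) ^ k j)⁻¹ * Complex.exp (β * x))
  have hlim : Tendsto (fun x => Matrix.of fun i j => r x i * (Matrix.of fun i j => s x j * T x i j) i j)
      atTop (𝓝 (Matrix.fromBlocks X (conj c • X.map conj) (c • X) (-X.map conj))) := by
    refine tendsto_pi_nhds.2 fun i => tendsto_pi_nhds.2 fun j => ?_
    rcases i with i | i <;> rcases j with j | j
    · refine (tendsto_shiftedUpper_inl ha β k i i.2 j).congr fun x => ?_
      simp only [scaleFactor, r, s, T, Matrix.of_apply, Sum.elim_inl, mul_assoc]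
    · refine (tendsto_shiftedUpper_inr ha β k i i.2 j).congr fun x => ?_
      simp only [scaleFactor, r, s, T, Matrix.of_apply, Sum.elim_inl, Sum.elim_inr, mul_assoc]
    · refine (tendsto_shiftedLower_inl ha β k i i.2 j).congr fun x => ?_
      simp only [scaleFactor, r, s, T, Matrix.of_apply, Sum.elim_inl, Sum.elim_inr, mul_assoc]
    · refine (tendsto_shiftedLower_inr ha β k i i.2 j).congr fun x => ?_
      simp only [scaleFactor, r, s, T, Matrix.of_apply, Sum.elim_inr, mul_assoc]
  have hdet := ((continuous_id.matrix_det.tendsto _).comp hlim).eventually_ne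
    (det_fromBlocks_conj_ne_zero hXdet c)
  obtain ⟨x, hx⟩ := hdet.exists
  simp only [Function.comp, id, Matrix.det_mul_column, Matrix.det_mul_row] at hx
  have hT : (T x).det ≠ 0 := right_ne_zero_of_mul (right_ne_zero_of_mul hx)
  refine ⟨(x, 0, 0), ?_⟩
  let G : Matrix (Fin n) (Fin n) ℂ := Matrix.of fun l i => shiftCoeff β l (n - 1 - (i : ℕ))
  -- Only the factorization is needed: a nonzero product already forces `δ₁ ≠ 0`.
  have hG : T x = Matrix.fromBlocks G 0 0 G
      * darbouxMatrix (psiFamily a β k) (phiFamily a β k) x 0 0 := by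
    ext i j
    rcases i with i | i
    · simp only [T, Matrix.of_apply, Sum.elim_inl, shiftedUpper]
      rw [← Finset.sum_range_reflect, Finset.sum_range]
      simp [Matrix.mul_apply, G, darbouxMatrix]
    · simp only [T, Matrix.of_apply, Sum.elim_inr, shiftedLower]
      rw [← Finset.sum_range_reflect, Finset.sum_range]
      simp [Matrix.mul_apply, G, darbouxMatrix]
  rw [hG, Matrix.det_mul] at hT
  exact right_ne_zero_of_mul hT

lemma isSeedFamily : IsSeedFamily (psiFamily a β k) (phiFamily a β k) a where
  smooth_psi j m := by
    have := analyticAt_seedRatio ha β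
    rw [psiFamily, dx_iterate_psiCoeff ha]
    exact smoothOn_seedJet ha β _ (by fun_prop) _
  smooth_phi j m := by
    have := analyticAt_seedRatio ha β
    rw [phiFamily, dx_iterate_phiCoeff ha]
    exact smoothOn_seedJet ha β _ (by fun_prop) _
  dy_psi j := dy_dx_iterate_psiCoeff ha β (k j)
  dy_phi j := dy_dx_iterate_phiCoeff ha β (k j)
  dt_psi j := dt_dx_iterate_psiCoeff ha β (k j)
  dt_phi j := dt_dx_iterate_phiCoeff ha β (k j)

lemma hasPolynomialJets : HasPolynomialJets (psiFamily a β k) (phiFamily a β k) (seedExp a β) := by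
  have hr := analyticAt_seedRatio ha β
  refine ⟨fun x y t => Complex.exp_ne_zero _, fun j m => ?_⟩
  obtain ⟨P, hP⟩ := seedJet_eq_seedExp_mul ha β (k j)
    (h := fun b => 1 / ((k j).factorial : ℂ) * (Complex.I * b) ^ m) (by fun_prop)
  obtain ⟨Q, hQ⟩ := seedJet_eq_seedExp_mul ha β (k j)
    (h := fun b => 1 / ((k j).factorial : ℂ) * seedRatio a b * (Complex.I * b) ^ m) (by fun_prop)
  refine ⟨P, Q, fun x y t => ⟨?_, ?_⟩⟩
  · rw [psiFamily, dx_iterate_psiCoeff ha, hP]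
  · rw [phiFamily, dx_iterate_phiCoeff ha, hQ]

end NonEmpty

end DaveyStewartson

theorem theorem1 (n : ℕ) [NeZero n] (a β : ℝ) (ha : a ≠ 0) (hβ : β ≠ 0)
    (k : Fin n → ℕ) (hk : Function.Injective k)
    (ψ φ : Fin n → ℝ → ℝ → ℝ → ℂ)
    (hψ : ∀ j, ψ j = psiCoeff a β (k j)) (hφ : ∀ j, φ j = phiCoeff a β (k j)) :
    (∀ j, IsLaxSolution (fun _ _ _ => (a : ℂ)) (fun _ _ _ => -(a : ℂ)) (fun _ _ _ => 0)
      (fun _ _ _ => 0) (ψ j) (φ j)) ∧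
    IsOpen (regularSet ψ φ) ∧ Dense (regularSet ψ φ) ∧
    IsRationalOn (regularSet ψ φ) (uDarboux a ψ φ) ∧
    ∃ S : ℝ → ℝ → ℝ → ℝ,
      IsRationalOn (regularSet ψ φ) (fun x y t => (S x y t : ℂ)) ∧
      IsDSIISolution (-1) (regularSet ψ φ) (uDarboux a ψ φ) S := by
  obtain rfl : ψ = psiFamily a β k := funext hψ
  obtain rfl : φ = phiFamily a β k := funext hφ
  have hp := hasPolynomialJets ha β k
  exact ⟨fun j => isLaxSolution_coeff ha β (k j), hp.isOpen_regularSet,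
    hp.dense_regularSet (regularSet_nonempty ha β k hk), hp.isRationalOn_uDarboux a,
    potential a _ _, hp.isRationalOn_potential a,
    (isSeedFamily ha β k).isDSIISolution hp.isOpen_regularSet⟩
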